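/- Let $K\ge 1$ and $0<\varepsilon^{100}<\varepsilon'<\varepsilon$ (so $\varepsilon<1$), and let $0<\delta<1$, $m\ge 1$, $0<\lambda<1$. Let $\mathcal T$ be a finite collection of $\delta\times\delta\times 1$ tubes in $\mathbb R^3$ (cylinders of length $1$ and diameter $\delta$) pointing in $\delta$-separated directions: for any two tubes of $\mathcal T$, with unit directions $v,v'$, either $v=\pm v'$ or $|v\mp v'|\ge\delta$ for both signs. Suppose that there are at most $Km$ parallel tubes in each direction. For each $T\in\mathcal T$ let $Y(T)\subset T$ be a measurable set (a shading) with $K^{-1}\lambda|T|\le|Y(T)|\le K\lambda|T|$. Suppose that each $Y(T)$ is quantitative two-ends at scale $\varepsilon'$: when $T$ is partitioned into $\lceil\delta^{-\varepsilon}\rceil$ segments $T_j$ of equal length, any two nonempty sets among the $Y(T)\cap T_j$ have measures comparable up to the factor $K$, and at least $\delta^{-\varepsilon'}$ of these sets are nonempty. Let $A=\bigcup_{T\in\mathcal T}Y(T)$. Below, $\beta>0$ is arbitrary, $C_\beta>0$ depends only on $\beta,\varepsilon,\varepsilon',K$, and the constants implied in $\sim$ depend only on $K$. Then $\sum_T|Y(T)|\sim\lambda(\delta^2|\mathcal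 T|)$ and, for all $\beta>0$, $$|A|\ \ge\ C_\beta^{-1}\,\delta^{\beta+(\varepsilon-\varepsilon')/2}\;\delta^{1/2}m^{-1}\lambda\sum_{T\in\mathcal T}|Y(T)|,\qquad |A|\ \ge\ C_\beta^{-1}\,\delta^{\beta+(\varepsilon-\varepsilon')/2}\;\delta^{1/2}m^{-1}\lambda^2(\delta^2|\mathcal T|).$$ (So $|A|\gtrapprox\delta^{1/2}m^{-1}\lambda^2(\delta^2|\mathcal T|)$ up to the loss $\delta^{(\varepsilon-\varepsilon')/2}$, which is at most $\delta^{-O(\varepsilon)}$ and is as harmless as $\delta^{\beta}$ once $\varepsilon$ is small compared to $\beta$.) Suppose moreover that every point of $\mathbb R^3$ lies in at most $K\delta^{-K}$ tubes of $\mathcal T$ (for example, that parallel tubes overlap boundedly). For dyadic $\mu\ge1$ let $A_\mu\subset A$ be the set of points that lie in at least $\mu$ and fewer than $2\mu$ of the sets $Y(T)$. Then there is a dyadic $\mu\ge 1$ such that, for all $\beta>0$: - $\sum_T|Y(T)|\ \ge\ \mu|A_\mu|\ \ge\ C_\beta^{-1}\delta^{\beta}\sum_T|Y(T)|$; - $|A_\mu|\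 \ge\ C_\beta^{-1}\delta^{\beta+(\varepsilon-\varepsilon')/2}\,\delta^{1/2}m^{-1}\lambda^2(\delta^2|\mathcal T|)$; - $\mu\lambda\ \le\ C_\beta\,\delta^{-\beta-(\varepsilon-\varepsilon')/2}\,\delta^{-1/2}m$; - $|A_{\mu'}|\ \le\ C_\beta\,\delta^{-\beta}\,\mu|A_\mu|/\mu'$ for every dyadic $\mu'\ge1$. -/

import Mathlib

open MeasureTheory

/-- Euclidean three-space. -/
abbrev R3 : Type := EuclideanSpace ℝ (Fin 3)

/-- The position of a tube in `ℝ³`: one end point of its axis, and the unit direction in which the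
axis (a segment of length `1`) leaves that end point. -/
structure Tube where
  base : R3
  dir : R3
  norm_dir : ‖dir‖ = 1

namespace Tube

/-- The coordinate of `x` along the axis, measured from the base point. -/
noncomputable def height (T : Tube) (x : R3) : ℝ := inner ℝ T.dir (x - T.base)

/-- The `δ × δ × 1` tube: the cylinder of length `1` and diameter `δ` around the axis. It is
half-open along the axis, so that it is an exact disjoint union of half-open segments. -/
def carrier (δ : ℝ) (T : Tube) : Set R3 :=
  {x | 0 ≤ T.height x ∧ T.height x < 1 ∧ ‖(x - T.base) - T.height x • T.dir‖ ≤ δ / 2}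

/-- The `j`-th of the `N` consecutive segments of length `1 / N` of the tube, `0 ≤ j < N`. -/
def segment (δ : ℝ) (T : Tube) (N j : ℕ) : Set R3 :=
  {x ∈ T.carrier δ | (j : ℝ) / N ≤ T.height x ∧ T.height x < ((j : ℝ) + 1) / N}

/-- Two tubes are parallel when they have the same direction up to sign. -/
def Parallel (T T' : Tube) : Prop := T.dir = T'.dir ∨ T.dir = -T'.dir

end Tube

/-- The tubes point in `δ`-separated directions: two tubes are parallel, or the lines
spanned by their directions are `δ`-separated. -/
def DirectionsSeparated (δ : ℝ) (𝒯 : Finset Tube) : Prop :=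
  ∀ T ∈ 𝒯, ∀ T' ∈ 𝒯, T.Parallel T' ∨ (δ ≤ ‖T.dir - T'.dir‖ ∧ δ ≤ ‖T.dir + T'.dir‖)

open Classical in
/-- In each direction there are at most `M` tubes. -/
def ParallelAtMost (M : ℝ) (𝒯 : Finset Tube) : Prop :=
  ∀ T ∈ 𝒯, ((𝒯.filter fun T' => T.Parallel T').card : ℝ) ≤ M

/-- The set `Y` is a shading of the tube `T` of density `∼ λ`, with implied constant `K`. -/
def IsShadingOfDensity (K δ lam : ℝ) (T : Tube) (Y : Set R3) : Prop :=
  Y ⊆ T.carrier δ ∧ MeasurableSet Y ∧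
    K⁻¹ * (lam * volume.real (T.carrier δ)) ≤ volume.real Y ∧
    volume.real Y ≤ K * (lam * volume.real (T.carrier δ))

open Classical in
/-- The shading `Y` of `T` is quantitative two-ends at scale `ε'`, with respect to the partition of
`T` into `⌈δ^(-ε)⌉` segments of equal length: the nonempty pieces of `Y` in the segments have
comparable measures (with implied constant `K`), and there are at least `δ^(-ε')` of them. -/
def IsTwoEnds (K ε ε' δ : ℝ) (T : Tube) (Y : Set R3) : Prop :=
  let N : ℕ := ⌈δ ^ (-ε)⌉₊
  let J : Finset ℕ := (Finset.range N).filter fun j => (Y ∩ T.segment δ N j).Nonempty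
  (∀ i ∈ J, ∀ j ∈ J,
    volume.real (Y ∩ T.segment δ N i) ≤ K * volume.real (Y ∩ T.segment δ N j)) ∧
  δ ^ (-ε') ≤ (J.card : ℝ)

open Classical in
/-- The number of tubes of `𝒯` whose set `Z T` contains the point `p`. -/
noncomputable def coverCount (𝒯 : Finset Tube) (Z : Tube → Set R3) (p : R3) : ℕ :=
  (𝒯.filter fun T => p ∈ Z T).card

/-- The set of the points that lie in `∼ μ` of the shadings, that is, in at least `μ` and fewer
than `2 μ` of them. -/
def multiplicityLevel (𝒯 : Finset Tube) (Y : Tube → Set R3) (μ : ℕ) : Set R3 :=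
  {p | μ ≤ coverCount 𝒯 Y p ∧ coverCount 𝒯 Y p < 2 * μ}

/-! The proof is Wolff's hairbrush argument, run on a single level of multiplicity. Let `n` be of
the order of `log (1 / δ)`. If `A_μ` carries a fraction `1 / O(n)` of the mass `∑ |Y(T)|`, then
`|A_μ|` is about the mass divided by `μ`, so everything reduces to the upper bound `μ λ ≲ δ^(-1/2 -
(ε - ε')/2) m`, which is `multiplicity_bound`.

Transversality. Of the tubes through a point of `A_μ`, at least half point into a cap of radius `∼
θ` in which each tube has at least `μ / (2 n)` partners at angle more than `θ`
(`exists_spread_cluster`). The dyadic number `θ` is made constant by pigeonholing. At the finest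
scale all tubes of the cluster are parallel and `μ ≤ 2 K m`. Otherwise integrating the number of
transversal pairs gives a stem `T₀` (`exists_stem`). Since two tubes at angle `θ` share a volume `≲
δ³ / θ`, the stem is crossed by `h ≳ μ λ θ / δ` tubes at angle `∼ θ`, up to powers of `n`: the
hairbrush.

Lower bound for the brush. By the two-ends condition half of each selected shading stays at distance
more than `r ∼ δ^(ε - ε')` (up to powers of `n`) from the stem. Two tubes of the brush that meet out
there nearly span a plane with the stem: the direction of one lies within `3 δ / r` of the plane of
the stem and the other (`Tube.mul_abs_inner_normal_le`). Hence one tube meets at most `∼ m ρ / (δ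
r)` others at angle `ρ ≥ δ`, each in volume `δ³ / ρ`, and every dyadic `ρ` contributes `m δ² / r`.
Córdoba's `L²` argument then bounds the volume of the brush from below by `h (λ δ²)² r / (m n δ²)`.

Upper bound. Every point of the brush lies in `∼ μ` tubes at angle `≲ θ` to the stem, and there are
only `≲ m θ² / δ²` such tubes, each with a shading of measure `≲ λ δ²`; so `μ` times the volume of
the brush is `≲ m θ² λ`. The two bounds meet in `hairbrush_card_le`. Eliminating `h` leaves `(μ λ)²
≲ m² θ δ^(-1) / r`, with `θ ≤ 1`.

Powers of `n` are absorbed into `δ^(-β)`. If `δ` is too large for the two-ends condition to beat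
them, then `δ` is bounded below and the trivial bound `μ ≤ |𝒯| ≲ m δ^(-2)` suffices. -/

/-! ### Orthonormal frames and volumes in coordinates -/

theorem exists_orthonormalBasis_adapted {v : R3} (hv : ‖v‖ = 1) (w : R3) :
    ∃ b : OrthonormalBasis (Fin 3) ℝ R3, b 0 = v ∧ inner ℝ (b 2) w = 0 := by
  -- The span of `v` and `w` has dimension at most `2`, also when they are dependent, so it has a
  -- nonzero normal.
  obtain ⟨n, hn0, hn⟩ : ∃ n : R3, n ≠ 0 ∧ ∀ x ∈ Submodule.span ℝ {v, w}, inner ℝ x n = 0 := by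
    have hlt : Module.finrank ℝ (Submodule.span ℝ ({v, w} : Set R3)) < 3 := by
      have := finrank_span_finset_le_card (R := ℝ) (M := R3) {v, w}
      have h2 : ({v, w} : Finset R3).card ≤ 2 := Finset.card_le_two
      simp only [Finset.coe_insert, Finset.coe_singleton] at this
      exact lt_of_le_of_lt (this.trans h2) (by norm_num)
    have hne : (Submodule.span ℝ ({v, w} : Set R3))ᗮ ≠ ⊥ := by
      intro h
      rw [Submodule.orthogonal_eq_bot_iff] at h
      rw [h, finrank_top] at hlt
      simp at hlt
    obtain ⟨n, hn, hn0⟩ := Submodule.exists_mem_ne_zero_of_ne_bot hne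
    exact ⟨n, hn0, fun x hx => (Submodule.mem_orthogonal _ _).1 hn x hx⟩
  have hnn : ‖n‖ ≠ 0 := by simpa using hn0
  set u : R3 := ‖n‖⁻¹ • n with hu
  have hu1 : ‖u‖ = 1 := by
    rw [hu, norm_smul, norm_inv, norm_norm, inv_mul_cancel₀ hnn]
  have hvu : inner ℝ v u = 0 := by
    rw [hu, inner_smul_right, hn v (Submodule.subset_span (by simp)), mul_zero]
  have hwu : inner ℝ w u = 0 := by
    rw [hu, inner_smul_right, hn w (Submodule.subset_span (by simp)), mul_zero]
  have hon : Orthonormal ℝ (({0, 2} : Set (Fin 3)).domRestrict ![v, 0, u]) := by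
    constructor
    · rintro ⟨i, hi⟩
      simp only [Set.mem_insert_iff, Set.mem_singleton_iff] at hi
      rcases hi with rfl | rfl <;> simp [hv, hu1]
    · rintro ⟨i, hi⟩ ⟨j, hj⟩ hij
      simp only [Set.mem_insert_iff, Set.mem_singleton_iff] at hi hj
      rcases hi with rfl | rfl <;> rcases hj with rfl | rfl
      · exact absurd rfl hij
      · simpa using hvu
      · simpa using (real_inner_comm v u).trans hvu
      · exact absurd rfl hij
  obtain ⟨b, hb⟩ := hon.exists_orthonormalBasis_extension_of_card_eq (by simp)
  refine ⟨b, by simpa using hb 0 (by simp), ?_⟩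
  have := hb 2 (by simp)
  simp only [Matrix.cons_val] at this
  rw [this, real_inner_comm]; exact hwu

theorem volume_coord_box (b : OrthonormalBasis (Fin 3) ℝ R3) (p : R3) (s : Fin 3 → Set ℝ)
    (hs : ∀ i, MeasurableSet (s i)) :
    volume {x : R3 | ∀ i, inner ℝ (b i) (x - p) ∈ s i} = ∏ i, volume (s i) := by
  have h1 : MeasurePreserving (fun x : R3 => x - p) volume volume :=
    measurePreserving_sub_right volume p
  have h2 := b.measurePreserving_repr
  have h3 := EuclideanSpace.volume_preserving_symm_measurableEquiv_toLp (Fin 3)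
  have h := h3.comp (h2.comp h1)
  have he : {x : R3 | ∀ i, inner ℝ (b i) (x - p) ∈ s i} =
      (⇑(MeasurableEquiv.toLp 2 (Fin 3 → ℝ)).symm ∘ ⇑b.repr ∘ fun x => x - p) ⁻¹'
        (Set.univ.pi s) := by
    ext x
    simp only [Set.mem_ofPred_eq, Set.mem_preimage, Set.mem_pi, Set.mem_univ, true_implies]
    refine forall_congr' fun i => ?_
    rw [← b.repr_apply_apply]
    rfl
  rw [he, h.measure_preimage (MeasurableSet.univ_pi hs).nullMeasurableSet, volume_pi_pi]

theorem OrthonormalBasis.norm_sq_fin_three (b : OrthonormalBasis (Fin 3) ℝ R3) (y : R3) :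
    ‖y‖ ^ 2 = inner ℝ (b 0) y ^ 2 + inner ℝ (b 1) y ^ 2 + inner ℝ (b 2) y ^ 2 := by
  have := b.sum_sq_norm_inner_right y
  rw [Fin.sum_univ_three] at this
  simpa [sq_abs] using this.symm

theorem norm_sub_inner_smul_sq {v : R3} (hv : ‖v‖ = 1) (y : R3) :
    ‖y - inner ℝ v y • v‖ ^ 2 = ‖y‖ ^ 2 - inner ℝ v y ^ 2 := by
  rw [norm_sub_sq_real, inner_smul_right, norm_smul, hv, real_inner_comm y v, Real.norm_eq_abs,
    mul_one, sq_abs]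
  ring

/-! ### Volumes of tubes and of their windows -/

namespace Tube

theorem measurable_height (T : Tube) : Measurable T.height := by
  unfold height; fun_prop

theorem measurableSet_carrier (δ : ℝ) (T : Tube) : MeasurableSet (T.carrier δ) := by
  have h := T.measurable_height
  have h3 : MeasurableSet {x : R3 | ‖(x - T.base) - T.height x • T.dir‖ ≤ δ / 2} :=
    measurableSet_le (by fun_prop) measurable_const
  exact (measurableSet_le measurable_const h).inter
    ((measurableSet_lt h measurable_const).inter h3)

/-- The part of a tube whose heights lie in a window of length `2 ℓ`. -/
theorem volume_window_le {δ : ℝ} (hδ : 0 ≤ δ) (T : Tube) (h : ℝ) {ℓ : ℝ} (hℓ : 0 ≤ ℓ) :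
    volume {x ∈ T.carrier δ | |T.height x - h| ≤ ℓ} ≤ ENNReal.ofReal (2 * ℓ * δ ^ 2) := by
  obtain ⟨b, hb, -⟩ := exists_orthonormalBasis_adapted T.norm_dir 0
  let s : Fin 3 → Set ℝ :=
    ![Set.Icc (h - ℓ) (h + ℓ), Set.Icc (-(δ / 2)) (δ / 2), Set.Icc (-(δ / 2)) (δ / 2)]
  have hsub : {x ∈ T.carrier δ | |T.height x - h| ≤ ℓ} ⊆
      {x : R3 | ∀ i, inner ℝ (b i) (x - T.base) ∈ s i} := by
    rintro x ⟨⟨-, -, hx⟩, hxh⟩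
    have h2 := norm_sub_inner_smul_sq T.norm_dir (x - T.base)
    rw [b.norm_sq_fin_three (x - T.base), hb] at h2
    change ‖(x - T.base) - inner ℝ T.dir (x - T.base) • T.dir‖ ≤ δ / 2 at hx
    have h3 := pow_le_pow_left₀ (norm_nonneg _) hx 2
    rw [abs_le] at hxh
    intro i
    fin_cases i
    · change inner ℝ (b 0) (x - T.base) ∈ Set.Icc (h - ℓ) (h + ℓ)
      rw [hb]
      unfold height at hxh
      constructor <;> linarith
    · change inner ℝ (b 1) (x - T.base) ∈ Set.Icc (-(δ / 2)) (δ / 2)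
      exact abs_le.1 (abs_le_of_sq_le_sq (by nlinarith [sq_nonneg (inner ℝ (b 2) (x - T.base))])
        (by positivity))
    · change inner ℝ (b 2) (x - T.base) ∈ Set.Icc (-(δ / 2)) (δ / 2)
      exact abs_le.1 (abs_le_of_sq_le_sq (by nlinarith [sq_nonneg (inner ℝ (b 1) (x - T.base))])
        (by positivity))
  refine (measure_mono hsub).trans ?_
  rw [volume_coord_box b T.base s (by intro i; fin_cases i <;> exact measurableSet_Icc),
    Fin.prod_univ_three]
  simp only [s, Matrix.cons_val, Real.volume_Icc]
  rw [← ENNReal.ofReal_mul (by linarith), ← ENNReal.ofReal_mul (by nlinarith)]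
  apply le_of_eq; congr 1; ring

theorem volume_carrier_le {δ : ℝ} (hδ : 0 ≤ δ) (T : Tube) :
    volume (T.carrier δ) ≤ ENNReal.ofReal (δ ^ 2) := by
  have := T.volume_window_le hδ (1 / 2) (ℓ := 1 / 2) (by norm_num)
  have he : {x ∈ T.carrier δ | |T.height x - 1 / 2| ≤ 1 / 2} = T.carrier δ := by
    refine Set.sep_eq_self_iff_mem_true.2 fun x hx => ?_
    rw [abs_le]
    constructor <;> linarith [hx.1, hx.2.1]
  rw [he] at this
  simpa using this

theorem volume_carrier_ne_top {δ : ℝ} (hδ : 0 ≤ δ) (T : Tube) : volume (T.carrier δ) ≠ ⊤ :=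
  ((T.volume_carrier_le hδ).trans_lt ENNReal.ofReal_lt_top).ne

theorem volume_real_carrier_le {δ : ℝ} (hδ : 0 ≤ δ) (T : Tube) :
    volume.real (T.carrier δ) ≤ δ ^ 2 :=
  ENNReal.toReal_le_of_le_ofReal (by positivity) (T.volume_carrier_le hδ)

theorem volume_real_window_le {δ : ℝ} (hδ : 0 ≤ δ) (T : Tube) (h : ℝ) {ℓ : ℝ} (hℓ : 0 ≤ ℓ) :
    volume.real {x ∈ T.carrier δ | |T.height x - h| ≤ ℓ} ≤ 2 * ℓ * δ ^ 2 :=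
  ENNReal.toReal_le_of_le_ofReal (by positivity) (T.volume_window_le hδ h hℓ)

theorem le_volume_real_carrier {δ : ℝ} (hδ : 0 ≤ δ) (T : Tube) :
    δ ^ 2 / 4 ≤ volume.real (T.carrier δ) := by
  obtain ⟨b, hb, -⟩ := exists_orthonormalBasis_adapted T.norm_dir 0
  let s : Fin 3 → Set ℝ :=
    ![Set.Ico 0 1, Set.Icc (-(δ / 4)) (δ / 4), Set.Icc (-(δ / 4)) (δ / 4)]
  have hsub : {x : R3 | ∀ i, inner ℝ (b i) (x - T.base) ∈ s i} ⊆ T.carrier δ := by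
    intro x hx
    have h0 : inner ℝ (b 0) (x - T.base) ∈ Set.Ico (0 : ℝ) 1 := hx 0
    have h1 : inner ℝ (b 1) (x - T.base) ∈ Set.Icc (-(δ / 4)) (δ / 4) := hx 1
    have h2 : inner ℝ (b 2) (x - T.base) ∈ Set.Icc (-(δ / 4)) (δ / 4) := hx 2
    rw [hb] at h0
    refine ⟨h0.1, h0.2, ?_⟩
    have h3 := norm_sub_inner_smul_sq T.norm_dir (x - T.base)
    rw [b.norm_sq_fin_three (x - T.base), hb] at h3
    refine abs_le_of_sq_le_sq' ?_ (by positivity) |>.2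
    change ‖(x - T.base) - inner ℝ T.dir (x - T.base) • T.dir‖ ^ 2 ≤ _
    rw [h3]
    nlinarith [h1.1, h1.2, h2.1, h2.2]
  have hm := measure_mono (μ := volume) hsub
  rw [volume_coord_box b T.base s
    (by intro i; fin_cases i; exacts [measurableSet_Ico, measurableSet_Icc, measurableSet_Icc]),
    Fin.prod_univ_three] at hm
  simp only [s, Matrix.cons_val, Real.volume_Icc, Real.volume_Ico] at hm
  rw [← ENNReal.ofReal_mul (by linarith), ← ENNReal.ofReal_mul (by nlinarith)] at hm
  have := (ENNReal.ofReal_le_iff_le_toReal (T.volume_carrier_ne_top hδ)).1 hm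
  refine le_trans (le_of_eq ?_) this
  ring

end Tube

/-! ### Angles between tubes and the geometry of their intersections -/

namespace Tube

/-- The distance between the directions of two tubes, up to sign. -/
noncomputable def sep (T T' : Tube) : ℝ := min ‖T.dir - T'.dir‖ ‖T.dir + T'.dir‖

theorem sep_comm (T T' : Tube) : T.sep T' = T'.sep T := by
  unfold sep
  rw [norm_sub_rev, add_comm]

theorem sep_nonneg (T T' : Tube) : 0 ≤ T.sep T' := le_min (norm_nonneg _) (norm_nonneg _)

theorem sep_le_two (T T' : Tube) : T.sep T' ≤ 2 := by
  refine (min_le_left _ _).trans ((norm_sub_le _ _).trans ?_)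
  rw [T.norm_dir, T'.norm_dir]; norm_num

theorem sep_triangle (T T' T'' : Tube) : T.sep T'' ≤ T.sep T' + T'.sep T'' := by
  unfold sep
  rcases min_choice ‖T.dir - T'.dir‖ ‖T.dir + T'.dir‖ with h | h <;>
  rcases min_choice ‖T'.dir - T''.dir‖ ‖T'.dir + T''.dir‖ with h' | h' <;> rw [h, h']
  · refine (min_le_left _ _).trans ?_
    simpa using norm_add_le (T.dir - T'.dir) (T'.dir - T''.dir)
  · refine (min_le_right _ _).trans ?_
    have := norm_add_le (T.dir - T'.dir) (T'.dir + T''.dir)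
    rwa [show T.dir - T'.dir + (T'.dir + T''.dir) = T.dir + T''.dir by abel] at this
  · refine (min_le_right _ _).trans ?_
    have := norm_sub_le (T.dir + T'.dir) (T'.dir - T''.dir)
    rwa [show T.dir + T'.dir - (T'.dir - T''.dir) = T.dir + T''.dir by abel] at this
  · refine (min_le_left _ _).trans ?_
    have := norm_sub_le (T.dir + T'.dir) (T'.dir + T''.dir)
    rwa [show T.dir + T'.dir - (T'.dir + T''.dir) = T.dir - T''.dir by abel] at this

/-- If `c` is the inner product of the directions, the squared separation is `2 (1 - |c|)`, and `c²
≤ |c|`. The right side is twice the squared sine of the angle. -/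
theorem sep_sq_le (T T' : Tube) : T.sep T' ^ 2 ≤ 2 * (1 - inner ℝ T.dir T'.dir ^ 2) := by
  have h1 : T.sep T' ^ 2 ≤ ‖T.dir - T'.dir‖ ^ 2 :=
    pow_le_pow_left₀ (sep_nonneg _ _) (min_le_left _ _) 2
  have h2 : T.sep T' ^ 2 ≤ ‖T.dir + T'.dir‖ ^ 2 :=
    pow_le_pow_left₀ (sep_nonneg _ _) (min_le_right _ _) 2
  rw [norm_sub_sq_real, T.norm_dir, T'.norm_dir] at h1
  rw [norm_add_sq_real, T.norm_dir, T'.norm_dir] at h2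
  have h3 := abs_real_inner_le_norm T.dir T'.dir
  rw [T.norm_dir, T'.norm_dir, abs_le] at h3
  rcases le_total 0 (inner ℝ T.dir T'.dir) with h | h <;> nlinarith

theorem abs_inner_le_sep {e : R3} (he : ‖e‖ = 1) {T : Tube} (h : inner ℝ e T.dir = 0) (T' : Tube) :
    |inner ℝ e T'.dir| ≤ T.sep T' := by
  refine le_min ?_ ?_
  · have := abs_real_inner_le_norm e (T.dir - T'.dir)
    rwa [inner_sub_right, h, he, one_mul, zero_sub, abs_neg] at this
  · have := abs_real_inner_le_norm e (T.dir + T'.dir)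
    rwa [inner_add_right, h, he, one_mul, zero_add] at this

theorem norm_sub_height_smul_le {δ : ℝ} {T : Tube} {x y : R3} (hx : x ∈ T.carrier δ)
    (hy : y ∈ T.carrier δ) : ‖(x - y) - (T.height x - T.height y) • T.dir‖ ≤ δ := by
  have h := norm_sub_le (x - T.base - T.height x • T.dir) (y - T.base - T.height y • T.dir)
  have he : x - T.base - T.height x • T.dir - (y - T.base - T.height y • T.dir) =
    (x - y) - (T.height x - T.height y) • T.dir := by rw [sub_smul]; abel
  rw [he] at h
  linarith [hx.2.2, hy.2.2]

theorem abs_inner_sub_le {δ : ℝ} {T : Tube} {x y e : R3} (he : ‖e‖ = 1) (hx : x ∈ T.carrier δ)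
    (hy : y ∈ T.carrier δ) :
    |inner ℝ e (x - y) - (T.height x - T.height y) * inner ℝ e T.dir| ≤ δ := by
  have h := abs_real_inner_le_norm e ((x - y) - (T.height x - T.height y) • T.dir)
  rw [inner_sub_right, inner_smul_right, he, one_mul] at h
  exact h.trans (norm_sub_height_smul_le hx hy)

/-- Both `s • T.dir` and `t • T'.dir` approximate `x - y` within `δ`, so they differ by at most `2
δ`. The part of `s • T.dir` orthogonal to `T'.dir` has length `|s|` times the sine of the angle, at
least `|s| * sep / √2`; and `2 √2 ≤ 3`. -/
theorem abs_height_sub_mul_sep_le {δ : ℝ} {T T' : Tube} {x y : R3}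
    (hx : x ∈ T.carrier δ) (hy : y ∈ T.carrier δ) (hx' : x ∈ T'.carrier δ)
    (hy' : y ∈ T'.carrier δ) : |T.height x - T.height y| * T.sep T' ≤ 3 * δ := by
  have hδ : 0 ≤ δ := by linarith [hx.2.2, norm_nonneg ((x - T.base) - T.height x • T.dir)]
  set s := T.height x - T.height y
  set t := T'.height x - T'.height y
  have h := norm_sub_le ((x - y) - t • T'.dir) ((x - y) - s • T.dir)
  rw [show (x - y) - t • T'.dir - ((x - y) - s • T.dir) = s • T.dir - t • T'.dir by abel] at h
  have h1 : ‖s • T.dir - t • T'.dir‖ ≤ 2 * δ := by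
    linarith [norm_sub_height_smul_le hx hy, norm_sub_height_smul_le hx' hy']
  have h2 := pow_le_pow_left₀ (norm_nonneg _) h1 2
  rw [norm_sub_sq_real, norm_smul, norm_smul, T.norm_dir, T'.norm_dir, inner_smul_left,
    inner_smul_right, Real.norm_eq_abs, Real.norm_eq_abs] at h2
  simp only [mul_one, sq_abs, conj_trivial] at h2
  refine abs_le_of_sq_le_sq' ?_ (by positivity) |>.2
  rw [mul_pow, sq_abs]
  have h3 := mul_le_mul_of_nonneg_left (sep_sq_le T T') (sq_nonneg s)
  nlinarith [sq_nonneg (t - s * inner ℝ T.dir T'.dir)]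

theorem volume_real_inter_le {δ : ℝ} (hδ : 0 ≤ δ) {T T' : Tube} (h : 0 < T.sep T') :
    volume.real (T.carrier δ ∩ T'.carrier δ) ≤ 6 * δ ^ 3 / T.sep T' := by
  rcases (T.carrier δ ∩ T'.carrier δ).eq_empty_or_nonempty with h0 | ⟨y, hy⟩
  · rw [h0]; simp; positivity
  have hℓ : 0 ≤ 3 * δ / T.sep T' := by positivity
  have hsub : T.carrier δ ∩ T'.carrier δ ⊆
      {x ∈ T.carrier δ | |T.height x - T.height y| ≤ 3 * δ / T.sep T'} := fun x hx =>
    ⟨hx.1, (le_div_iff₀ h).2 (abs_height_sub_mul_sep_le hx.1 hy.1 hx.2 hy.2)⟩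
  have hfin : volume {x ∈ T.carrier δ | |T.height x - T.height y| ≤ 3 * δ / T.sep T'} ≠ ⊤ :=
    ((T.volume_window_le hδ _ hℓ).trans_lt ENNReal.ofReal_lt_top).ne
  refine (measureReal_mono hsub hfin).trans ((T.volume_real_window_le hδ _ hℓ).trans
    (le_of_eq (by ring)))

/-- If two tubes `T'`, `T''` that cross `T₀` meet each other away from `T₀`, then the direction of
`T''` is close to the plane of the directions of `T₀` and `T'`. -/
theorem mul_abs_inner_normal_le {δ r : ℝ} {T₀ T' T'' : Tube} {e x' x'' y : R3} (he : ‖e‖ = 1)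
    (h₀ : inner ℝ e T₀.dir = 0) (h' : inner ℝ e T'.dir = 0)
    (hx'₀ : x' ∈ T₀.carrier δ) (hx' : x' ∈ T'.carrier δ) (hx''₀ : x'' ∈ T₀.carrier δ)
    (hx'' : x'' ∈ T''.carrier δ) (hy' : y ∈ T'.carrier δ) (hy'' : y ∈ T''.carrier δ)
    (hr : r ≤ |T''.height y - T''.height x''|) : r * |inner ℝ e T''.dir| ≤ 3 * δ := by
  -- The coordinate along `e` changes by at most `δ` along each of `T₀` and `T'`, whose axes are
  -- orthogonal to `e`. With the error from the width of `T''` this makes `3 * δ`.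
  have h1 := abs_inner_sub_le he hx'₀ hx''₀
  have h2 := abs_inner_sub_le he hy' hx'
  have h3 := abs_inner_sub_le he hy'' hx''
  rw [h₀, mul_zero, sub_zero] at h1
  rw [h', mul_zero, sub_zero] at h2
  have h4 : inner ℝ e (y - x'') = inner ℝ e (y - x') + inner ℝ e (x' - x'') := by
    rw [← inner_add_right]; congr 1; abel
  rw [h4] at h3
  have h5 : r * |inner ℝ e T''.dir| ≤ |(T''.height y - T''.height x'') * inner ℝ e T''.dir| := by
    rw [abs_mul]; gcongr
  refine h5.trans ?_
  rw [abs_le] at h1 h2 h3 ⊢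
  constructor <;> linarith

end Tube

/-! ### Counting tubes by their directions -/

theorem DirectionsSeparated.mono {δ : ℝ} {F 𝒯 : Finset Tube} (h : DirectionsSeparated δ 𝒯)
    (hF : F ⊆ 𝒯) : DirectionsSeparated δ F := fun T hT T' hT' => h T (hF hT) T' (hF hT')

open Classical in
theorem ParallelAtMost.mono {M : ℝ} {F 𝒯 : Finset Tube} (h : ParallelAtMost M 𝒯)
    (hF : F ⊆ 𝒯) : ParallelAtMost M F := fun T hT =>
  le_trans (Nat.cast_le.2 (Finset.card_le_card (Finset.filter_subset_filter _ hF))) (h T (hF hT))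

theorem DirectionsSeparated.parallel_of_sep_lt {δ : ℝ} {𝒯 : Finset Tube}
    (h : DirectionsSeparated δ 𝒯) {T T' : Tube} (hT : T ∈ 𝒯) (hT' : T' ∈ 𝒯)
    (hs : T.sep T' < δ) : T.Parallel T' := by
  rcases h T hT T' hT' with h | h
  · exact h
  · exact absurd hs (not_lt.2 (le_min h.1 h.2))

theorem card_Icc_floor_le {a : ℝ} (ha : 0 ≤ a) :
    ((Finset.Icc ⌊-a⌋ ⌊a⌋).card : ℝ) ≤ 2 * a + 2 := by
  rw [Int.card_Icc]
  have h1 : ⌊-a⌋ ≤ ⌊a⌋ := Int.floor_le_floor (by linarith)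
  have h2 : (((⌊a⌋ + 1 - ⌊-a⌋).toNat : ℕ) : ℝ) = (⌊a⌋ : ℝ) + 1 - ⌊-a⌋ := by
    have : (((⌊a⌋ + 1 - ⌊-a⌋).toNat : ℕ) : ℤ) = ⌊a⌋ + 1 - ⌊-a⌋ := Int.toNat_of_nonneg (by omega)
    exact_mod_cast congrArg (Int.cast : ℤ → ℝ) this
  rw [h2]
  linarith [Int.floor_le a, Int.lt_floor_add_one (-a)]

open Classical in
-- After a change of sign the directions lie on the part of the sphere where the `g` coordinate is
-- at least `1 / 2`, and there the other two coordinates form a bi-Lipschitz chart. Directions in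
-- one cell of side `δ / 8` are closer than `δ`, hence parallel, so a cell holds at most `M` tubes.
theorem card_le_of_large_coord {δ M α w : ℝ} (hδ : 0 < δ) (hα : 0 ≤ α) (hw : 0 ≤ w)
    {F : Finset Tube} (hsep : DirectionsSeparated δ F) (hpar : ParallelAtMost M F) (hM : 0 ≤ M)
    {e f g : R3}
    (hn : ∀ y : R3, ‖y‖ ^ 2 = inner ℝ e y ^ 2 + inner ℝ f y ^ 2 + inner ℝ g y ^ 2)
    (he : ∀ T ∈ F, |inner ℝ e T.dir| ≤ α) (hf : ∀ T ∈ F, |inner ℝ f T.dir| ≤ w)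
    (hg : ∀ T ∈ F, 1 / 2 ≤ |inner ℝ g T.dir|) :
    (F.card : ℝ) ≤ 256 * M * (α / δ + 1) * (w / δ + 1) := by
  let s : Tube → ℝ := fun T => if 0 ≤ inner ℝ g T.dir then 1 else -1
  have hs : ∀ T, s T = 1 ∨ s T = -1 := fun T => by
    by_cases h : 0 ≤ inner ℝ g T.dir <;> simp [s, h]
  have hsabs : ∀ T, |s T| = 1 := fun T => by rcases hs T with h | h <;> simp [h]
  have hsg : ∀ T ∈ F, 1 / 2 ≤ s T * inner ℝ g T.dir := by
    intro T hT
    have := hg T hT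
    by_cases h : 0 ≤ inner ℝ g T.dir
    · simpa [s, h, abs_of_nonneg h] using this
    · simpa [s, h, abs_of_neg (not_le.1 h)] using this
  let Φ : Tube → ℤ × ℤ := fun T =>
    (⌊8 / δ * (s T * inner ℝ e T.dir)⌋, ⌊8 / δ * (s T * inner ℝ f T.dir)⌋)
  have hpar' : ∀ T ∈ F, ∀ T' ∈ F, Φ T = Φ T' → T.Parallel T' := by
    intro T hT T' hT' hΦ
    apply hsep.parallel_of_sep_lt hT hT'
    have hcell : ∀ a b : ℝ, ⌊8 / δ * a⌋ = ⌊8 / δ * b⌋ → |a - b| < δ / 8 := by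
      intro a b hab
      have := Int.abs_sub_lt_one_of_floor_eq_floor hab
      rw [← mul_sub, abs_mul, abs_of_pos (by positivity), div_mul_eq_mul_div,
        div_lt_iff₀ hδ] at this
      linarith
    have h1 := hcell _ _ (Prod.ext_iff.1 hΦ).1
    have h2 := hcell _ _ (Prod.ext_iff.1 hΦ).2
    have hnT : ∀ T : Tube, (s T * inner ℝ e T.dir) ^ 2 + (s T * inner ℝ f T.dir) ^ 2 +
        (s T * inner ℝ g T.dir) ^ 2 = 1 := by
      intro T
      have := hn T.dir
      rw [T.norm_dir] at this
      have hs2 : s T ^ 2 = 1 := by rcases hs T with h | h <;> simp [h]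
      rw [mul_pow, mul_pow, mul_pow, hs2]; linarith
    have hsub := hn (s T • T.dir - s T' • T'.dir)
    simp only [inner_sub_right, inner_smul_right] at hsub
    have n1 := hnT T
    have n2 := hnT T'
    have g1 := hsg T hT
    have g2 := hsg T' hT'
    have hlt : ‖s T • T.dir - s T' • T'.dir‖ < δ := by
      refine lt_of_pow_lt_pow_left₀ 2 hδ.le ?_
      rw [hsub]
      generalize s T * inner ℝ e T.dir = a at *
      generalize s T' * inner ℝ e T'.dir = a' at *
      generalize s T * inner ℝ f T.dir = c at *
      generalize s T' * inner ℝ f T'.dir = c' at *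
      generalize s T * inner ℝ g T.dir = z at *
      generalize s T' * inner ℝ g T'.dir = z' at *
      have habs : ∀ x y z : ℝ, x ^ 2 + y ^ 2 + z ^ 2 = 1 → |x| ≤ 1 := fun x y z h =>
        abs_le_one_iff_mul_self_le_one.2 (by nlinarith)
      -- On the unit sphere `z² - z'²` is controlled by the other two coordinates, and `z + z' ≥ 1`
      -- allows the division.
      have hz : |z - z'| ≤ δ / 2 := by
        have e1 : (z - z') * (z + z') = (a' - a) * (a + a') + (c' - c) * (c + c') := by
          linarith
        have e2 : |z - z'| * (z + z') ≤ δ / 8 * 2 + δ / 8 * 2 := by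
          rw [← abs_of_nonneg (show 0 ≤ z + z' by linarith), ← abs_mul, e1]
          refine (abs_add_le _ _).trans (add_le_add ?_ ?_)
          · rw [abs_mul, abs_sub_comm]
            refine mul_le_mul h1.le ((abs_add_le _ _).trans ?_) (abs_nonneg _) (by positivity)
            linarith [habs a c z n1, habs a' c' z' n2]
          · rw [abs_mul, abs_sub_comm]
            refine mul_le_mul h2.le ((abs_add_le _ _).trans ?_) (abs_nonneg _) (by positivity)
            linarith [habs c a z (by linarith), habs c' a' z' (by linarith)]
        nlinarith [abs_nonneg (z - z')]
      have q1 := sq_lt_sq' (abs_lt.1 h1).1 (abs_lt.1 h1).2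
      have q2 := sq_lt_sq' (abs_lt.1 h2).1 (abs_lt.1 h2).2
      have q3 := sq_le_sq' (abs_le.1 hz).1 (abs_le.1 hz).2
      nlinarith [sq_pos_of_pos hδ]
    refine lt_of_le_of_lt ?_ hlt
    unfold Tube.sep
    rcases hs T with h | h <;> rcases hs T' with h' | h' <;> rw [h, h']
    · simp
    · simp
    · rw [show (-1 : ℝ) • T.dir - (1 : ℝ) • T'.dir = -(T.dir + T'.dir) by
        simp [sub_eq_add_neg, add_comm], norm_neg]
      exact min_le_right _ _
    · rw [show (-1 : ℝ) • T.dir - (-1 : ℝ) • T'.dir = -(T.dir - T'.dir) by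
        simp [sub_eq_add_neg, add_comm], norm_neg]
      exact min_le_left _ _
  have hfib : ∀ z ∈ F.image Φ, ((F.filter fun T => Φ T = z).card : ℝ) ≤ M := by
    intro z hz
    obtain ⟨T, hT, rfl⟩ := Finset.mem_image.1 hz
    refine le_trans (Nat.cast_le.2 (Finset.card_le_card ?_)) (hpar T hT)
    intro T' hT'
    rw [Finset.mem_filter] at hT' ⊢
    exact ⟨hT'.1, hpar' T hT T' hT'.1 hT'.2.symm⟩
  have himg : F.image Φ ⊆ Finset.Icc ⌊-(8 / δ * α)⌋ ⌊8 / δ * α⌋ ×ˢ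
      Finset.Icc ⌊-(8 / δ * w)⌋ ⌊8 / δ * w⌋ := by
    intro z hz
    obtain ⟨T, hT, rfl⟩ := Finset.mem_image.1 hz
    have hin : ∀ a x : ℝ, |x| ≤ a → ⌊8 / δ * (s T * x)⌋ ∈
        Finset.Icc ⌊-(8 / δ * a)⌋ ⌊8 / δ * a⌋ := by
      intro a x hx
      have hx' : |s T * x| ≤ a := by rwa [abs_mul, hsabs, one_mul]
      have h8 : 0 < 8 / δ := by positivity
      rw [abs_le] at hx'
      rw [Finset.mem_Icc]
      exact ⟨Int.floor_le_floor (by nlinarith), Int.floor_le_floor (by nlinarith)⟩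
    exact Finset.mem_product.2 ⟨hin _ _ (he T hT), hin _ _ (hf T hT)⟩
  have hcard : ((F.image Φ).card : ℝ) ≤ 16 * (α / δ + 1) * (16 * (w / δ + 1)) := by
    refine le_trans (Nat.cast_le.2 (Finset.card_le_card himg)) ?_
    rw [Finset.card_product, Nat.cast_mul]
    have hA := card_Icc_floor_le (a := 8 / δ * α) (by positivity)
    have hW := card_Icc_floor_le (a := 8 / δ * w) (by positivity)
    refine mul_le_mul (hA.trans ?_) (hW.trans ?_) (by positivity) (by positivity)
    · rw [show 8 / δ * α = 8 * (α / δ) by ring]; linarith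
    · rw [show 8 / δ * w = 8 * (w / δ) by ring]; linarith
  rw [Finset.card_eq_sum_card_image Φ F, Nat.cast_sum]
  refine (Finset.sum_le_sum hfib).trans ?_
  rw [Finset.sum_const, nsmul_eq_mul]
  calc _ ≤ 16 * (α / δ + 1) * (16 * (w / δ + 1)) * M := by gcongr
    _ = _ := by ring

open Classical in
/-- The number of tubes whose directions lie in a rectangle of side lengths `α` and `w`. -/
theorem card_le_of_coords {δ M α w : ℝ} (hδ : 0 < δ) (hα : 0 ≤ α) (hw : 0 ≤ w)
    {F : Finset Tube} (hsep : DirectionsSeparated δ F) (hpar : ParallelAtMost M F) (hM : 0 ≤ M)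
    (b : OrthonormalBasis (Fin 3) ℝ R3)
    (h1 : ∀ T ∈ F, |inner ℝ (b 1) T.dir| ≤ α) (h2 : ∀ T ∈ F, |inner ℝ (b 2) T.dir| ≤ w) :
    (F.card : ℝ) ≤ 2560 * M * (α / δ + 1) * (w / δ + 1) := by
  have hle1 : ∀ i, ∀ T : Tube, |inner ℝ (b i) T.dir| ≤ 1 := by
    intro i T
    have := abs_real_inner_le_norm (b i) T.dir
    rwa [T.norm_dir, b.norm_eq_one, one_mul] at this
  -- Some coordinate of a unit vector has size at least `1 / 2`, because `3 / 4 < 1`.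
  let G : Fin 3 → Finset Tube := fun i => F.filter fun T => 1 / 2 ≤ |inner ℝ (b i) T.dir|
  have hGF : ∀ i, G i ⊆ F := fun i => Finset.filter_subset _ _
  have hcov : F ⊆ G 0 ∪ G 1 ∪ G 2 := by
    intro T hT
    simp only [G, Finset.mem_union, Finset.mem_filter, hT, true_and]
    by_contra! hcon
    have := b.norm_sq_fin_three T.dir
    rw [T.norm_dir, ← sq_abs (inner ℝ (b 0) _), ← sq_abs (inner ℝ (b 1) _),
      ← sq_abs (inner ℝ (b 2) _)] at this
    nlinarith [hcon.1.1, hcon.1.2, hcon.2, abs_nonneg (inner ℝ (b 0) T.dir),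
      abs_nonneg (inner ℝ (b 1) T.dir), abs_nonneg (inner ℝ (b 2) T.dir)]
  have hgG : ∀ i, ∀ T ∈ G i, 1 / 2 ≤ |inner ℝ (b i) T.dir| := fun i T hT =>
    (Finset.mem_filter.1 hT).2
  have hc : (F.card : ℝ) ≤ (G 0).card + (G 1).card + (G 2).card := by
    exact_mod_cast (Finset.card_le_card hcov).trans
      ((Finset.card_union_le _ _).trans (by gcongr; exact Finset.card_union_le _ _))
  have hP : 0 ≤ M * (α / δ + 1) * (w / δ + 1) := by positivity
  have c0 : ((G 0).card : ℝ) ≤ 256 * M * (α / δ + 1) * (w / δ + 1) :=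
    card_le_of_large_coord hδ hα hw (hsep.mono (hGF 0)) (hpar.mono (hGF 0)) hM
      (e := b 1) (f := b 2) (g := b 0) (fun y => by rw [b.norm_sq_fin_three y]; ring)
      (fun T hT => h1 T (hGF 0 hT)) (fun T hT => h2 T (hGF 0 hT)) (hgG 0)
  -- If the coordinate bounded by `α` is the large one, then `α ≥ 1 / 2`, and the trivial bound `1`
  -- for the coordinate along `b 0` can replace `α` at the cost of a factor `2`. The same holds for
  -- `w` below.
  have c1 : ((G 1).card : ℝ) ≤ 512 * (M * (α / δ + 1) * (w / δ + 1)) := by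
    rcases (G 1).eq_empty_or_nonempty with h | ⟨T, hT⟩
    · rw [h]; simp; positivity
    have hα2 : 1 ≤ 2 * α := by linarith [h1 T (hGF 1 hT), hgG 1 T hT]
    refine (card_le_of_large_coord hδ zero_le_one hw (hsep.mono (hGF 1)) (hpar.mono (hGF 1)) hM
      (e := b 0) (f := b 2) (g := b 1) (fun y => by rw [b.norm_sq_fin_three y]; ring)
      (fun T hT => hle1 0 T) (fun T hT => h2 T (hGF 1 hT)) (hgG 1)).trans ?_
    have : 1 / δ + 1 ≤ 2 * (α / δ + 1) := by
      have := div_le_div_of_nonneg_right hα2 hδ.le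
      rw [mul_div_assoc] at this; linarith
    calc _ ≤ 256 * M * (2 * (α / δ + 1)) * (w / δ + 1) := by gcongr
      _ = _ := by ring
  have c2 : ((G 2).card : ℝ) ≤ 512 * (M * (α / δ + 1) * (w / δ + 1)) := by
    rcases (G 2).eq_empty_or_nonempty with h | ⟨T, hT⟩
    · rw [h]; simp; positivity
    have hw2 : 1 ≤ 2 * w := by linarith [h2 T (hGF 2 hT), hgG 2 T hT]
    refine (card_le_of_large_coord hδ hα zero_le_one (hsep.mono (hGF 2)) (hpar.mono (hGF 2)) hM
      (e := b 1) (f := b 0) (g := b 2) (fun y => by rw [b.norm_sq_fin_three y]; ring)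
      (fun T hT => h1 T (hGF 2 hT)) (fun T hT => hle1 0 T) (hgG 2)).trans ?_
    have : 1 / δ + 1 ≤ 2 * (w / δ + 1) := by
      have := div_le_div_of_nonneg_right hw2 hδ.le
      rw [mul_div_assoc] at this; linarith
    calc _ ≤ 256 * M * (α / δ + 1) * (2 * (w / δ + 1)) := by gcongr
      _ = _ := by ring
  nlinarith

/-! ### Double counting by integration, and Cauchy–Schwarz -/

section Counting

open Classical in
theorem card_filter_eq_sum_indicator {ι X : Type*} (F : Finset ι) (Z : ι → Set X) (x : X) :
    ((F.filter fun i => x ∈ Z i).card : ℝ) = ∑ i ∈ F, (Z i).indicator (fun _ => (1 : ℝ)) x := by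
  rw [Finset.card_filter]
  push_cast
  exact Finset.sum_congr rfl fun i _ => by simp [Set.indicator_apply]

variable {ι X : Type*} [MeasurableSpace X] {μ : Measure X}

theorem integrableOn_indicator_one {E Z : Set X} (hE : μ E ≠ ⊤) (hZ : MeasurableSet Z) :
    Integrable (Z.indicator fun _ => (1 : ℝ)) (μ.restrict E) := by
  have : IsFiniteMeasure (μ.restrict E) := ⟨by simpa using hE.lt_top⟩
  exact (integrable_const (1 : ℝ)).indicator hZ

open Classical in
theorem integrableOn_card_filter (F : Finset ι) {Z : ι → Set X} {E : Set X} (hE : μ E ≠ ⊤)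
    (hZ : ∀ i ∈ F, MeasurableSet (Z i)) :
    IntegrableOn (fun x => ((F.filter fun i => x ∈ Z i).card : ℝ)) E μ := by
  simp only [card_filter_eq_sum_indicator]
  exact integrable_finsetSum _ fun i hi => integrableOn_indicator_one hE (hZ i hi)

open Classical in
theorem setIntegral_card_filter (F : Finset ι) {Z : ι → Set X} {E : Set X} (hE : μ E ≠ ⊤)
    (hZ : ∀ i ∈ F, MeasurableSet (Z i)) :
    ∫ x in E, ((F.filter fun i => x ∈ Z i).card : ℝ) ∂μ = ∑ i ∈ F, μ.real (Z i ∩ E) := by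
  simp only [card_filter_eq_sum_indicator]
  rw [integral_finsetSum _ fun i hi => integrableOn_indicator_one hE (hZ i hi)]
  refine Finset.sum_congr rfl fun i hi => ?_
  rw [integral_indicator (hZ i hi), setIntegral_const, smul_eq_mul, mul_one,
    measureReal_restrict_apply (hZ i hi)]

open Classical in
theorem mul_measureReal_le_sum (F : Finset ι) {Z : ι → Set X} {E : Set X} (hE : μ E ≠ ⊤)
    (hEm : MeasurableSet E) (hZ : ∀ i ∈ F, MeasurableSet (Z i)) {a : ℝ}
    (h : ∀ x ∈ E, a ≤ ((F.filter fun i => x ∈ Z i).card : ℝ)) :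
    a * μ.real E ≤ ∑ i ∈ F, μ.real (Z i ∩ E) := by
  rw [← setIntegral_card_filter F hE hZ, mul_comm]
  have := setIntegral_mono_on (integrableOn_const hE : IntegrableOn (fun _ => a) E μ)
    (integrableOn_card_filter F hE hZ) hEm h
  rwa [setIntegral_const, smul_eq_mul] at this

open Classical in
theorem sum_le_mul_measureReal (F : Finset ι) {Z : ι → Set X} {E : Set X} (hE : μ E ≠ ⊤)
    (hEm : MeasurableSet E) (hZ : ∀ i ∈ F, MeasurableSet (Z i)) {a : ℝ}
    (h : ∀ x ∈ E, ((F.filter fun i => x ∈ Z i).card : ℝ) ≤ a) :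
    ∑ i ∈ F, μ.real (Z i ∩ E) ≤ a * μ.real E := by
  rw [← setIntegral_card_filter F hE hZ, mul_comm]
  have := setIntegral_mono_on (integrableOn_card_filter F hE hZ)
    (integrableOn_const hE : IntegrableOn (fun _ => a) E μ) hEm h
  rwa [setIntegral_const, smul_eq_mul] at this

open Classical in
-- Cauchy–Schwarz on `E` for the function that counts the sets `Z i` through a point; its square
-- counts pairs. It is read off from the discriminant of `t ↦ ∫ (g - t)² ≥ 0`.
theorem sq_sum_measureReal_le (F : Finset ι) {Z : ι → Set X} {E : Set X} (hE : μ E ≠ ⊤)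
    (hZ : ∀ i ∈ F, MeasurableSet (Z i)) :
    (∑ i ∈ F, μ.real (Z i ∩ E)) ^ 2 ≤
      μ.real E * ∑ i ∈ F, ∑ j ∈ F, μ.real (Z i ∩ Z j ∩ E) := by
  set g : X → ℝ := fun x => ((F.filter fun i => x ∈ Z i).card : ℝ) with hg
  obtain ⟨W, hW⟩ : ∃ W : ι × ι → Set X, ∀ p, W p = Z p.1 ∩ Z p.2 := ⟨_, fun _ => rfl⟩
  have hsq : (fun x => g x ^ 2) = fun x =>
      (((F ×ˢ F).filter fun p => x ∈ W p).card : ℝ) := by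
    funext x
    rw [hg, sq, ← Nat.cast_mul, ← Finset.card_product, ← Finset.filter_product]
    congr 2
    ext p
    simp only [Finset.mem_filter, hW, Set.mem_inter_iff]
  have hZ2 : ∀ p ∈ F ×ˢ F, MeasurableSet (W p) := fun p hp => hW p ▸
    (hZ _ (Finset.mem_product.1 hp).1).inter (hZ _ (Finset.mem_product.1 hp).2)
  have hgi : IntegrableOn g E μ := integrableOn_card_filter F hE hZ
  have hg2 : IntegrableOn (fun x => g x ^ 2) E μ := by
    rw [hsq]; exact integrableOn_card_filter (F ×ˢ F) hE hZ2
  have e1 : ∫ x in E, g x ∂μ = ∑ i ∈ F, μ.real (Z i ∩ E) := setIntegral_card_filter F hE hZ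
  have e2 : ∫ x in E, g x ^ 2 ∂μ = ∑ i ∈ F, ∑ j ∈ F, μ.real (Z i ∩ Z j ∩ E) := by
    rw [hsq, setIntegral_card_filter (F ×ˢ F) hE hZ2, Finset.sum_product]
    simp only [hW]
  rw [← e1, ← e2]
  set I := ∫ x in E, g x ∂μ
  set Q := ∫ x in E, g x ^ 2 ∂μ
  have hmain : ∀ t : ℝ, 0 ≤ μ.real E * (t * t) + (-2 * I) * t + Q := by
    intro t
    have h0 : 0 ≤ ∫ x in E, (g x - t) ^ 2 ∂μ := integral_nonneg fun x => sq_nonneg _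
    have h1 : ∫ x in E, (g x - t) ^ 2 ∂μ = Q - 2 * t * I + μ.real E * t ^ 2 := by
      have hc : IntegrableOn (fun _ : X => t ^ 2) E μ := integrableOn_const hE
      have hm : IntegrableOn (fun x => 2 * t * g x) E μ := hgi.const_mul _
      have hgm : IntegrableOn (fun x => g x ^ 2 - 2 * t * g x) E μ := hg2.sub hm
      have : (fun x => (g x - t) ^ 2) = fun x => (g x ^ 2 - 2 * t * g x) + t ^ 2 := by
        funext x; ring
      rw [this, integral_add hgm hc, integral_sub hg2 hm, integral_const_mul,
        setIntegral_const, smul_eq_mul]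
    rw [h1] at h0
    linarith
  have := discrim_le_zero hmain
  rw [discrim] at this
  nlinarith

open Classical in
/-- A condition on the set of the indices `i` with `x ∈ Y i` is measurable in `x`. -/
theorem measurableSet_filter_mem (F : Finset ι) {Y : ι → Set X}
    (hY : ∀ i ∈ F, MeasurableSet (Y i)) (P : Finset ι → Prop) :
    MeasurableSet {x | P (F.filter fun i => x ∈ Y i)} := by
  -- Only finitely many index sets `σ` can occur, and each of them occurs on a finite intersection
  -- of sets `Y i` and complements.
  have he : {x | P (F.filter fun i => x ∈ Y i)} =
      ⋃ σ ∈ F.powerset.filter P, ⋂ i ∈ F, {x | x ∈ Y i ↔ i ∈ σ} := by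
    ext x
    simp only [Set.mem_ofPred_eq, Set.mem_iUnion, Set.mem_iInter, Finset.mem_filter,
      Finset.mem_powerset, exists_prop]
    constructor
    · intro h
      exact ⟨_, ⟨Finset.filter_subset _ _, h⟩, fun i hi => by simp [hi]⟩
    · rintro ⟨σ, ⟨hσ, hP⟩, h⟩
      convert hP
      ext i
      rw [Finset.mem_filter]
      exact ⟨fun hi => (h i hi.1).1 hi.2, fun hi => ⟨hσ hi, (h i (hσ hi)).2 hi⟩⟩
  rw [he]
  refine Finset.measurableSet_biUnion _ fun σ _ => Finset.measurableSet_biInter _ fun i hi => ?_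
  by_cases h : i ∈ σ
  · simpa [h] using hY i hi
  · simp only [h, iff_false]
    exact (hY i hi).compl

end Counting

/-! ### The two-ends condition on short windows -/

theorem card_natCast_mem_Ioc_le {a b : ℝ} (hab : a ≤ b) (J : Finset ℕ)
    (hJ : ∀ j ∈ J, a < (j : ℝ) ∧ (j : ℝ) ≤ b) : (J.card : ℝ) ≤ b - a + 1 := by
  have hsub : J.map ⟨(Nat.cast : ℕ → ℤ), Nat.cast_injective⟩ ⊆ Finset.Ioc ⌊a⌋ ⌊b⌋ := by
    intro z hz
    obtain ⟨j, hj, rfl⟩ := Finset.mem_map.1 hz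
    simp only [Function.Embedding.coeFn_mk, Finset.mem_Ioc]
    exact ⟨Int.floor_lt.2 (by exact_mod_cast (hJ j hj).1),
      Int.le_floor.2 (by exact_mod_cast (hJ j hj).2)⟩
  have h := Finset.card_le_card hsub
  rw [Finset.card_map, Int.card_Ioc] at h
  have h1 : ⌊a⌋ ≤ ⌊b⌋ := Int.floor_le_floor hab
  have h2 : (J.card : ℤ) ≤ ⌊b⌋ - ⌊a⌋ := by omega
  have h3 : (J.card : ℝ) ≤ (⌊b⌋ : ℝ) - ⌊a⌋ := by exact_mod_cast h2
  linarith [Int.floor_le b, Int.lt_floor_add_one a]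

open Classical in
/-- A two-ends shading has only a small part in a short window. -/
theorem IsTwoEnds.volume_window_le {K ε ε' δ : ℝ} (hK : 1 ≤ K) (hε : 0 < ε) (hδ : 0 < δ)
    (hδ1 : δ < 1) {T : Tube} {Y : Set R3} (h : IsTwoEnds K ε ε' δ T Y) (hYT : Y ⊆ T.carrier δ)
    (hY : MeasurableSet Y) (hc : ℝ) {r : ℝ} (hr : 0 ≤ r) :
    volume.real {y ∈ Y | |T.height y - hc| ≤ r} ≤
      (4 * r * δ ^ (-ε) + 2) * (K * volume.real Y * δ ^ ε') := by
  unfold IsTwoEnds at h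
  set N : ℕ := ⌈δ ^ (-ε)⌉₊ with hN
  set J : Finset ℕ := (Finset.range N).filter fun j => (Y ∩ T.segment δ N j).Nonempty with hJ
  obtain ⟨hcomp, hcard⟩ := h
  have hfin : volume Y ≠ ⊤ :=
    ((measure_mono hYT).trans_lt (T.volume_carrier_ne_top hδ.le).lt_top).ne
  have hone : 1 ≤ δ ^ (-ε) := Real.one_le_rpow_of_pos_of_le_one_of_nonpos hδ hδ1.le (by linarith)
  have hN2 : (N : ℝ) ≤ 2 * δ ^ (-ε) := by
    linarith [(Nat.ceil_lt_add_one (show 0 ≤ δ ^ (-ε) by positivity)).le]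
  have hNpos : (0 : ℝ) < N := by
    exact_mod_cast Nat.ceil_pos.2 (by linarith)
  have hmeasseg : ∀ j, MeasurableSet (Y ∩ T.segment δ N j) := fun j =>
    hY.inter ((T.measurableSet_carrier δ).inter
      ((measurableSet_le measurable_const T.measurable_height).inter
        (measurableSet_lt T.measurable_height measurable_const)))
  have hdisj : Set.PairwiseDisjoint (J : Set ℕ) fun j => Y ∩ T.segment δ N j := by
    have key : ∀ i j : ℕ, ∀ x : R3, x ∈ T.segment δ N i → x ∈ T.segment δ N j → i ≤ j := by
      rintro i j x ⟨-, hi, -⟩ ⟨-, -, hj⟩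
      have := hi.trans_lt hj
      rw [div_lt_div_iff_of_pos_right hNpos] at this
      exact Nat.lt_succ_iff.1 (by exact_mod_cast this)
    intro i _ j _ hij
    refine Set.disjoint_left.2 fun x hx hx' => hij (le_antisymm ?_ ?_)
    · exact key _ _ x hx.2 hx'.2
    · exact key _ _ x hx'.2 hx.2
  have hsum : ∑ j ∈ J, volume.real (Y ∩ T.segment δ N j) ≤ volume.real Y := by
    rw [← measureReal_biUnion_finset hdisj (fun j _ => hmeasseg j)
      (fun j _ => ((measure_mono Set.inter_subset_left).trans_lt hfin.lt_top).ne)]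
    exact measureReal_mono (Set.iUnion₂_subset fun j _ => Set.inter_subset_left) hfin
  have hδε : 0 < δ ^ (-ε') := by positivity
  -- One piece is at most `K` times each of the `δ ^ (-ε')` or more nonempty pieces, whose measures
  -- add up to at most that of `Y`.
  have hpiece : ∀ i ∈ J, volume.real (Y ∩ T.segment δ N i) ≤ K * volume.real Y * δ ^ ε' := by
    intro i hi
    have h1 : (J.card : ℝ) * volume.real (Y ∩ T.segment δ N i) ≤ K * volume.real Y := by
      rw [← nsmul_eq_mul, ← Finset.sum_const]
      refine (Finset.sum_le_sum fun j hj => hcomp i hi j hj).trans ?_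
      rw [← Finset.mul_sum]
      gcongr
    have h2 : δ ^ (-ε') * volume.real (Y ∩ T.segment δ N i) ≤ K * volume.real Y :=
      (mul_le_mul_of_nonneg_right hcard measureReal_nonneg).trans h1
    rw [Real.rpow_neg hδ.le, inv_mul_le_iff₀ (by positivity)] at h2
    linarith
  -- A point at height `t` lies in the segment `j` with `j ≤ t * N < j + 1`. The resulting interval
  -- of indices has length `2 r N + 1`, so it holds at most `2 r N + 2` integers, and `N ≤ 2 δ ^
  -- (-ε)`.
  set J' := J.filter fun j : ℕ => (hc - r) * N - 1 < (j : ℝ) ∧ (j : ℝ) ≤ (hc + r) * N with hJ'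
  have hJ'card : (J'.card : ℝ) ≤ 4 * r * δ ^ (-ε) + 2 := by
    refine (card_natCast_mem_Ioc_le (a := (hc - r) * N - 1) (b := (hc + r) * N) (by nlinarith) J'
      fun j hj => (Finset.mem_filter.1 hj).2).trans ?_
    nlinarith
  have hcov : {y ∈ Y | |T.height y - hc| ≤ r} ⊆ ⋃ j ∈ J', Y ∩ T.segment δ N j := by
    rintro y ⟨hy, hyh⟩
    have hyc := hYT hy
    have hpos : 0 ≤ T.height y * N := mul_nonneg hyc.1 hNpos.le
    have f1 := Nat.floor_le hpos
    have f2 := Nat.lt_floor_add_one (T.height y * N)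
    have hseg : y ∈ T.segment δ N ⌊T.height y * N⌋₊ :=
      ⟨hyc, (div_le_iff₀ hNpos).2 f1, (lt_div_iff₀ hNpos).2 f2⟩
    rw [abs_le] at hyh
    simp only [Set.mem_iUnion]
    refine ⟨⌊T.height y * N⌋₊, ?_, hy, hseg⟩
    rw [hJ', Finset.mem_filter, hJ, Finset.mem_filter, Finset.mem_range]
    refine ⟨⟨?_, ⟨y, hy, hseg⟩⟩, by nlinarith, by nlinarith⟩
    refine (Nat.floor_lt hpos).2 ?_
    nlinarith [hyc.2.1]
  have hfinU : volume (⋃ j ∈ J', Y ∩ T.segment δ N j) ≠ ⊤ :=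
    ((measure_mono (Set.iUnion₂_subset fun j _ => Set.inter_subset_left)).trans_lt hfin.lt_top).ne
  refine (measureReal_mono hcov hfinU).trans ((measureReal_biUnion_finset_le _ _).trans ?_)
  refine (Finset.sum_le_sum fun j hj => hpiece j (Finset.mem_filter.1 hj).1).trans ?_
  rw [Finset.sum_const, nsmul_eq_mul]
  gcongr

/-! ### Clusters and caps of directions -/

open Classical in
/-- Most of a finite set of tubes points into a cap inside which the directions are spread out. -/
theorem exists_spread_cluster (n : ℕ) (S : Finset Tube) :
    ∃ i ≤ n, ∃ S' ⊆ S, (1 - (i : ℝ) / (2 * n)) * S.card ≤ S'.card ∧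
      (∀ T ∈ S', ∀ T' ∈ S', T.sep T' ≤ 4 * (1 / 2) ^ i) ∧
      (i < n → ∀ T ∈ S', (S.card : ℝ) / (2 * n) ≤
        ((S'.filter fun T' => (1 / 2) ^ i < T.sep T').card : ℝ)) := by
  let P : ℕ → Prop := fun i => ∃ S' ⊆ S, (1 - (i : ℝ) / (2 * n)) * S.card ≤ S'.card ∧
      (∀ T ∈ S', ∀ T' ∈ S', T.sep T' ≤ 4 * (1 / 2) ^ i)
  have hP0 : P 0 := ⟨S, subset_rfl, by simp, fun T _ T' _ => by
    simpa using (T.sep_le_two T').trans (by norm_num)⟩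
  have hPi := Nat.findGreatest_spec (P := P) (Nat.zero_le n) hP0
  have hle : Nat.findGreatest P n ≤ n := Nat.findGreatest_le n
  set i := Nat.findGreatest P n with hi
  obtain ⟨S', hS', hcard, hdiam⟩ := hPi
  refine ⟨i, hle, S', hS', hcard, hdiam, fun hin T hT => ?_⟩
  -- The scale `i` is the last one with a large cluster. If some `T` had too few partners beyond `2
  -- ^ (-i)`, discarding them would leave a ball of radius `2 ^ (-i)` around `T`, of diameter at
  -- most `4 * 2 ^ (-(i + 1))`, and lose only `|S| / (2 n)` tubes: a cluster at scale `i + 1`.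
  by_contra! hcon
  have hnot : ¬ P (i + 1) := Nat.findGreatest_is_greatest (Nat.lt_succ_self _) hin
  apply hnot
  refine ⟨S'.filter fun T' => ¬ (1 / 2) ^ i < T.sep T', (Finset.filter_subset _ _).trans hS',
    ?_, ?_⟩
  · have h1 := Finset.card_filter_add_card_filter_not (s := S')
      (fun T' => (1 / 2 : ℝ) ^ i < T.sep T')
    have h2 : ((S'.filter fun T' => (1 / 2 : ℝ) ^ i < T.sep T').card : ℝ) +
        (S'.filter fun T' => ¬ (1 / 2 : ℝ) ^ i < T.sep T').card = S'.card := by exact_mod_cast h1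
    have h3 : (1 - ((i + 1 : ℕ) : ℝ) / (2 * n)) * S.card =
        (1 - (i : ℝ) / (2 * n)) * S.card - S.card / (2 * n) := by
      push_cast; ring
    rw [h3]; linarith
  · intro A hA B hB
    have hA' := not_lt.1 (Finset.mem_filter.1 hA).2
    have hB' := not_lt.1 (Finset.mem_filter.1 hB).2
    rw [Tube.sep_comm] at hA'
    have := A.sep_triangle T B
    rw [pow_succ]
    linarith

open Classical in
theorem card_cap_le {δ M a : ℝ} (hδ : 0 < δ) (ha : 0 ≤ a) {𝒯 : Finset Tube}
    (hsep : DirectionsSeparated δ 𝒯) (hpar : ParallelAtMost M 𝒯) (hM : 0 ≤ M) (T₀ : Tube) :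
    ((𝒯.filter fun T => T₀.sep T ≤ a).card : ℝ) ≤ 2560 * M * (a / δ + 1) * (a / δ + 1) := by
  obtain ⟨b, hb, -⟩ := exists_orthonormalBasis_adapted T₀.norm_dir 0
  have hperp : ∀ i, i ≠ 0 → inner ℝ (b i) T₀.dir = 0 := fun i hi => by
    rw [← hb]; exact b.orthonormal.2 hi
  have hcoord : ∀ i, i ≠ 0 → ∀ T ∈ 𝒯.filter fun T => T₀.sep T ≤ a, |inner ℝ (b i) T.dir| ≤ a :=
    fun i hi T hT => (Tube.abs_inner_le_sep (b.norm_eq_one i) (hperp i hi) T).trans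
      (Finset.mem_filter.1 hT).2
  exact card_le_of_coords hδ ha ha (hsep.mono (Finset.filter_subset _ _))
    (hpar.mono (Finset.filter_subset _ _)) hM b (hcoord 1 (by decide)) (hcoord 2 (by decide))

theorem exists_dyadic_sep {s : ℝ} (hs2 : s ≤ 2) {n : ℕ} (hs : (1 / 2) ^ n < s) :
    ∃ j ≤ n, (1 / 2 : ℝ) ^ j < s ∧ s ≤ 2 * (1 / 2) ^ j := by
  classical
  have hex : ∃ j, (1 / 2 : ℝ) ^ j < s := ⟨n, hs⟩
  refine ⟨Nat.find hex, Nat.find_min' hex hs, Nat.find_spec hex, ?_⟩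
  rcases Nat.eq_zero_or_pos (Nat.find hex) with h | h
  · rw [h]; simpa using hs2
  · have := not_lt.1 (Nat.find_min hex (Nat.sub_lt h one_pos))
    obtain ⟨k, hk⟩ := Nat.exists_eq_succ_of_ne_zero h.ne'
    rw [hk] at this ⊢
    simp only [Nat.succ_eq_add_one, Nat.add_sub_cancel] at this
    rw [Nat.succ_eq_add_one, pow_succ]; linarith

/-! ### The hairbrush -/

open Classical in
/-- A dyadic form of the bound `δ³ / ∠` for the volume of the intersection of two tubes. -/
theorem Tube.volume_real_inter_le_sum {δ : ℝ} (hδ : 0 < δ) {n : ℕ} (hn : 4 < 2 ^ n * δ)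
    (T T' : Tube) : volume.real (T.carrier δ ∩ T'.carrier δ) ≤
      ∑ j ∈ Finset.range (n + 1),
        6 * δ ^ 3 * 2 ^ j * (if T.sep T' ≤ 2 * (1 / 2) ^ j then 1 else 0) := by
  have hnn : ∀ j ∈ Finset.range (n + 1),
      0 ≤ 6 * δ ^ 3 * 2 ^ j * (if T.sep T' ≤ 2 * (1 / 2) ^ j then (1 : ℝ) else 0) := by
    intro j _; split_ifs <;> positivity
  have hsuff : ∀ j ≤ n, T.sep T' ≤ 2 * (1 / 2) ^ j →
      volume.real (T.carrier δ ∩ T'.carrier δ) ≤ 6 * δ ^ 3 * 2 ^ j → _ := fun j hj h1 h2 =>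
    (h2.trans (by rw [if_pos h1, mul_one])).trans
      (Finset.single_le_sum hnn (Finset.mem_range.2 (Nat.lt_succ_of_le hj)))
  -- Below the finest scale the volume `δ²` of the whole tube will do: the last summand exceeds it
  -- because `2 ^ n * δ > 4`.
  rcases le_or_gt (T.sep T') ((1 / 2) ^ n) with h | h
  · refine hsuff n le_rfl (h.trans (by linarith [pow_pos (one_half_pos (α := ℝ)) n])) ?_
    refine (measureReal_mono Set.inter_subset_left (T.volume_carrier_ne_top hδ.le)).trans
      ((T.volume_real_carrier_le hδ.le).trans ?_)
    nlinarith [sq_pos_of_pos hδ]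
  · obtain ⟨j, hj, h1, h2⟩ := exists_dyadic_sep (T.sep_le_two T') h
    refine hsuff j hj h2 ?_
    have hpos : (0 : ℝ) < (1 / 2) ^ j := by positivity
    refine (Tube.volume_real_inter_le hδ.le (hpos.trans h1)).trans ?_
    rw [div_le_iff₀ (hpos.trans h1)]
    have : (1 : ℝ) ≤ 2 ^ j * T.sep T' := by
      calc (1 : ℝ) = 2 ^ j * (1 / 2) ^ j := by rw [← mul_pow]; norm_num
        _ ≤ _ := by gcongr
    calc 6 * δ ^ 3 = 6 * δ ^ 3 * 1 := by ring
      _ ≤ 6 * δ ^ 3 * (2 ^ j * T.sep T') := by gcongr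
      _ = _ := by ring

open Classical in
/-- The overlap of one tube of a hairbrush with the others, away from the stem. -/
theorem sum_inter_hairbrush_le {δ M r : ℝ} (hδ : 0 < δ) {n : ℕ} (hn : 4 < 2 ^ n * δ)
    (hn' : 2 ^ n * δ ≤ 8) {H : Finset Tube} (hsep : DirectionsSeparated δ H)
    (hpar : ParallelAtMost M H) (hM : 0 ≤ M) (hr : 0 < r) (hr1 : r ≤ 1) {T₀ : Tube}
    {Z : Tube → Set R3} (hZ : ∀ T ∈ H, Z T ⊆ T.carrier δ)
    (hx : ∀ T ∈ H, ∃ x ∈ T₀.carrier δ, x ∈ T.carrier δ ∧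
      ∀ y ∈ Z T, r ≤ |T.height y - T.height x|) {T' : Tube} (hT' : T' ∈ H) :
    ∑ T ∈ H, volume.real (Z T' ∩ Z T) ≤ 614400 * M * (n + 1) * δ ^ 2 / r := by
  -- `b 2` is normal to the directions of `T'` and of the stem. Tubes that meet `T'` away from the
  -- stem thus have directions in a thin rectangle, of width `3 δ / r` along `b 2`.
  obtain ⟨b, hb0, hb2⟩ := exists_orthonormalBasis_adapted T'.norm_dir T₀.dir
  have hperp : ∀ i, i ≠ 0 → inner ℝ (b i) T'.dir = 0 := fun i hi => by
    rw [← hb0]; exact b.orthonormal.2 hi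
  set H₁ := H.filter fun T => (Z T' ∩ Z T).Nonempty with hH₁
  have hH₁H : H₁ ⊆ H := Finset.filter_subset _ _
  have hplane : ∀ T ∈ H₁, |inner ℝ (b 2) T.dir| ≤ 3 * δ / r := by
    intro T hT
    obtain ⟨hTH, y, hy', hy⟩ := Finset.mem_filter.1 hT
    obtain ⟨x', hx'₀, hx', -⟩ := hx T' hT'
    obtain ⟨x'', hx''₀, hx'', hr''⟩ := hx T hTH
    rw [le_div_iff₀ hr, mul_comm]
    exact Tube.mul_abs_inner_normal_le (b.norm_eq_one 2) hb2 (hperp 2 (by decide)) hx'₀ hx' hx''₀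
      hx'' (hZ T' hT' hy') (hZ T hTH hy) (hr'' y hy)
  -- The number of tubes at angle at most `2 * 2 ^ (-j)` is `≲ M 2 ^ (-j) / (δ r)`, which cancels
  -- the weight `2 ^ j`. All scales contribute equally, and the sum costs only the factor `n + 1`.
  have hcount : ∀ j ∈ Finset.range (n + 1),
      2 ^ j * ((H₁.filter fun T => T'.sep T ≤ 2 * (1 / 2) ^ j).card : ℝ) ≤
        102400 * M / (δ * r) := by
    intro j hj
    have hsub : (H₁.filter fun T => T'.sep T ≤ 2 * (1 / 2) ^ j) ⊆ H :=
      (Finset.filter_subset _ _).trans hH₁H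
    have hc := card_le_of_coords hδ (α := 2 * (1 / 2) ^ j) (w := 3 * δ / r) (by positivity)
      (by positivity) (hsep.mono hsub) (hpar.mono hsub) hM b
      (fun T hT => (Tube.abs_inner_le_sep (b.norm_eq_one 1) (hperp 1 (by decide)) T).trans
        (Finset.mem_filter.1 hT).2)
      (fun T hT => hplane T (Finset.mem_filter.1 hT).1)
    have h2j : (2 : ℝ) ^ j ≤ 2 ^ n :=
      pow_le_pow_right₀ (by norm_num) (Nat.lt_succ_iff.1 (Finset.mem_range.1 hj))
    have h1 : (2 : ℝ) ^ j * (2 * (1 / 2) ^ j / δ + 1) ≤ 10 / δ := by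
      have h3 : (2 : ℝ) ^ j * (1 / 2) ^ j = 1 := by rw [← mul_pow]; norm_num
      have h4 : (2 : ℝ) ^ j ≤ 8 / δ := by rw [le_div_iff₀ hδ]; nlinarith
      calc (2 : ℝ) ^ j * (2 * (1 / 2) ^ j / δ + 1) = 2 * (2 ^ j * (1 / 2) ^ j) / δ + 2 ^ j := by
            ring
        _ ≤ 2 * 1 / δ + 8 / δ := by rw [h3]; gcongr
        _ = 10 / δ := by ring
    have h2 : 3 * δ / r / δ + 1 ≤ 4 / r := by
      have : 3 * δ / r / δ = 3 / r := by field_simp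
      rw [this, show (4 : ℝ) / r = 3 / r + 1 / r by ring]
      gcongr
      exact (one_le_div hr).2 hr1
    calc 2 ^ j * ((H₁.filter fun T => T'.sep T ≤ 2 * (1 / 2) ^ j).card : ℝ)
        ≤ 2 ^ j * (2560 * M * (2 * (1 / 2) ^ j / δ + 1) * (3 * δ / r / δ + 1)) := by gcongr
      _ = 2560 * M * (2 ^ j * (2 * (1 / 2) ^ j / δ + 1)) * (3 * δ / r / δ + 1) := by ring
      _ ≤ 2560 * M * (10 / δ) * (4 / r) := by gcongr
      _ = _ := by field_simp; ring
  have hzero : ∀ T ∈ H, T ∉ H₁ → volume.real (Z T' ∩ Z T) = 0 := by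
    intro T hT hT1
    have : ¬ (Z T' ∩ Z T).Nonempty := fun h => hT1 (Finset.mem_filter.2 ⟨hT, h⟩)
    rw [Set.not_nonempty_iff_eq_empty.1 this, measureReal_empty]
  rw [← Finset.sum_subset hH₁H hzero]
  calc ∑ T ∈ H₁, volume.real (Z T' ∩ Z T)
      ≤ ∑ T ∈ H₁, ∑ j ∈ Finset.range (n + 1),
          6 * δ ^ 3 * 2 ^ j * (if T'.sep T ≤ 2 * (1 / 2) ^ j then 1 else 0) := by
        refine Finset.sum_le_sum fun T hT => ?_
        refine le_trans (measureReal_mono (Set.inter_subset_inter (hZ T' hT') (hZ T (hH₁H hT)))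
          ?_) (Tube.volume_real_inter_le_sum hδ hn T' T)
        exact ((measure_mono Set.inter_subset_left).trans_lt
          (T'.volume_carrier_ne_top hδ.le).lt_top).ne
    _ = ∑ j ∈ Finset.range (n + 1), 6 * δ ^ 3 *
          (2 ^ j * ((H₁.filter fun T => T'.sep T ≤ 2 * (1 / 2) ^ j).card : ℝ)) := by
        rw [Finset.sum_comm]
        refine Finset.sum_congr rfl fun j _ => ?_
        rw [← Finset.mul_sum, Finset.sum_boole]
        ring
    _ ≤ ∑ j ∈ Finset.range (n + 1), 6 * δ ^ 3 * (102400 * M / (δ * r)) := by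
        refine Finset.sum_le_sum fun j hj => ?_
        exact mul_le_mul_of_nonneg_left (hcount j hj) (by positivity)
    _ = _ := by
        rw [Finset.sum_const, Finset.card_range, nsmul_eq_mul]
        push_cast
        field_simp
        ring

open Classical in
/-- The hairbrush estimate. The tubes of `H` cross the stem `T₀`, their directions are `4 θ`-close
to that of the stem, and their shadings `W` are spread out along them. -/
theorem hairbrush_card_le {δ M r θ a ν B : ℝ} (hδ : 0 < δ) {n : ℕ} (hn : 4 < 2 ^ n * δ)
    (hn' : 2 ^ n * δ ≤ 8) {𝒯 H : Finset Tube} (hH : H ⊆ 𝒯) (hsep : DirectionsSeparated δ 𝒯)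
    (hpar : ParallelAtMost M 𝒯) (hM : 0 ≤ M) (hr : 0 < r) (hr1 : r ≤ 1) (hθ : δ ≤ 4 * θ)
    (ha : 0 ≤ a) (hν : 0 ≤ ν) (hB : 0 ≤ B) {T₀ : Tube}
    {Y W : Tube → Set R3} (hYm : ∀ T ∈ 𝒯, MeasurableSet (Y T))
    (hYB : ∀ T ∈ 𝒯, volume.real (Y T) ≤ B) (hYT : ∀ T ∈ 𝒯, Y T ⊆ T.carrier δ)
    (hWm : ∀ T ∈ 𝒯, MeasurableSet (W T)) (hWY : ∀ T ∈ 𝒯, W T ⊆ Y T)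
    (hWa : ∀ T ∈ H, a ≤ volume.real (W T))
    (hx : ∀ T ∈ H, (T₀.carrier δ ∩ T.carrier δ).Nonempty)
    (hnear : ∀ T ∈ H, ∀ h, volume.real {y ∈ W T | |T.height y - h| ≤ r} ≤ a / 2)
    (hmult : ∀ T ∈ H, ∀ y ∈ W T,
      ν ≤ (((𝒯.filter fun T => T₀.sep T ≤ 8 * θ).filter fun T => y ∈ Y T).card : ℝ)) :
    ν * H.card * a ^ 2 ≤ 10 ^ 12 * M ^ 2 * (n + 1) * θ ^ 2 * B / r := by
  rcases H.eq_empty_or_nonempty with h0 | hHne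
  · rw [h0]; simp; positivity
  choose! x hx using hx
  let Z : Tube → Set R3 := fun T => {y ∈ W T | r < |T.height y - T.height (x T)|}
  set U : Set R3 := ⋃ T ∈ H, W T with hU
  have hUm : MeasurableSet U := Finset.measurableSet_biUnion _ fun T hT => hWm T (hH hT)
  have hWfin : ∀ T ∈ 𝒯, volume (W T) ≠ ⊤ := fun T hT =>
    ((measure_mono ((hWY T hT).trans (hYT T hT))).trans_lt
      (T.volume_carrier_ne_top hδ.le).lt_top).ne
  have hUfin : volume U ≠ ⊤ :=
    (measure_biUnion_lt_top H.finite_toSet fun T hT => (hWfin T (hH hT)).lt_top).ne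
  have hZm : ∀ T ∈ H, MeasurableSet (Z T) := by
    intro T hT
    have h1 : MeasurableSet {y : R3 | r < |T.height y - T.height (x T)|} := by
      have := T.measurable_height
      exact measurableSet_lt measurable_const (this.sub_const _).abs
    exact (hWm T (hH hT)).inter h1
  have hZW : ∀ T, Z T ⊆ W T := fun T y hy => hy.1
  have hZU : ∀ T ∈ H, Z T ∩ U = Z T := fun T hT =>
    Set.inter_eq_left.2 ((hZW T).trans (Set.subset_biUnion_of_mem (u := W) hT))
  have hZa : ∀ T ∈ H, a / 2 ≤ volume.real (Z T) := by
    intro T hT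
    have hun : W T ⊆ Z T ∪ {y ∈ W T | |T.height y - T.height (x T)| ≤ r} := by
      intro y hy
      rcases lt_or_ge r |T.height y - T.height (x T)| with h | h
      · exact Or.inl ⟨hy, h⟩
      · exact Or.inr ⟨hy, h⟩
    have hfin : volume (Z T ∪ {y ∈ W T | |T.height y - T.height (x T)| ≤ r}) ≠ ⊤ :=
      ((measure_mono (Set.union_subset (hZW T) fun y hy => hy.1)).trans_lt
        (hWfin T (hH hT)).lt_top).ne
    have := (measureReal_mono hun hfin).trans (measureReal_union_le _ _)
    linarith [hWa T hT, hnear T hT (T.height (x T))]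
  have hcs := sq_sum_measureReal_le H hUfin hZm
  have hsum1 : H.card * (a / 2) ≤ ∑ T ∈ H, volume.real (Z T ∩ U) := by
    rw [← nsmul_eq_mul, ← Finset.sum_const]
    exact Finset.sum_le_sum fun T hT => by rw [hZU T hT]; exact hZa T hT
  have hsum2 : ∑ T ∈ H, ∑ T' ∈ H, volume.real (Z T ∩ Z T' ∩ U) ≤
      H.card * (614400 * M * (n + 1) * δ ^ 2 / r) := by
    rw [← nsmul_eq_mul, ← Finset.sum_const]
    refine Finset.sum_le_sum fun T hT => ?_
    refine le_trans (Finset.sum_le_sum fun T' hT' => ?_)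
      (sum_inter_hairbrush_le hδ hn hn' (hsep.mono hH) (hpar.mono hH) hM hr hr1 (T₀ := T₀) (Z := Z)
        (fun T hT => (hZW T).trans ((hWY T (hH hT)).trans (hYT T (hH hT))))
        (fun T hT => ⟨x T, (hx T hT).1, (hx T hT).2, fun y hy => hy.2.le⟩) hT)
    rw [Set.inter_assoc, hZU T' hT']
  have hcard : (0 : ℝ) < H.card := by exact_mod_cast hHne.card_pos
  -- Córdoba's argument: small pairwise overlaps force a large union.
  have hlow : H.card * a ^ 2 ≤
      4 * volume.real U * (614400 * M * (n + 1) * δ ^ 2 / r) := by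
    have h1 : (H.card * (a / 2)) ^ 2 ≤
        volume.real U * (H.card * (614400 * M * (n + 1) * δ ^ 2 / r)) :=
      (pow_le_pow_left₀ (by positivity) hsum1 2).trans
        (hcs.trans (mul_le_mul_of_nonneg_left hsum2 measureReal_nonneg))
    refine le_of_mul_le_mul_left ?_ hcard
    nlinarith
  set Cap := 𝒯.filter fun T => T₀.sep T ≤ 8 * θ with hCap
  have hθ0 : 0 < θ := by linarith
  -- Conversely the points of `U` are covered `ν` times by the tubes of the cap, of which there are
  -- `≲ M θ² / δ²`.
  have hupper : ν * volume.real U ≤ 368640 * M * (θ ^ 2 / δ ^ 2) * B := by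
    have h1 : ν * volume.real U ≤ ∑ T ∈ Cap, volume.real (Y T ∩ U) := by
      refine mul_measureReal_le_sum Cap hUfin hUm
        (fun T hT => hYm T (Finset.mem_filter.1 hT).1) fun y hy => ?_
      simp only [hU, Set.mem_iUnion] at hy
      obtain ⟨T, hT, hyT⟩ := hy
      exact hmult T hT y hyT
    have h2 : ∑ T ∈ Cap, volume.real (Y T ∩ U) ≤ Cap.card * B := by
      rw [← nsmul_eq_mul, ← Finset.sum_const]
      refine Finset.sum_le_sum fun T hT => ?_
      have hT𝒯 := (Finset.mem_filter.1 hT).1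
      refine (measureReal_mono Set.inter_subset_left ?_).trans (hYB T hT𝒯)
      exact ((measure_mono (hYT T hT𝒯)).trans_lt (T.volume_carrier_ne_top hδ.le).lt_top).ne
    have h3 := card_cap_le hδ (a := 8 * θ) (by positivity) hsep hpar hM T₀
    have h4 : 8 * θ / δ + 1 ≤ 12 * (θ / δ) := by
      have : 1 ≤ 4 * θ / δ := (one_le_div hδ).2 hθ
      rw [show 12 * (θ / δ) = 8 * θ / δ + 4 * θ / δ by ring]
      linarith
    refine (h1.trans h2).trans ?_
    calc (Cap.card : ℝ) * B ≤ (2560 * M * (8 * θ / δ + 1) * (8 * θ / δ + 1)) * B := by gcongr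
      _ ≤ (2560 * M * (12 * (θ / δ)) * (12 * (θ / δ))) * B := by gcongr
      _ = _ := by rw [← div_pow]; ring
  calc ν * H.card * a ^ 2 = ν * (H.card * a ^ 2) := by ring
    _ ≤ ν * (4 * volume.real U * (614400 * M * (n + 1) * δ ^ 2 / r)) := by gcongr
    _ = (ν * volume.real U) * (4 * (614400 * M * (n + 1) * δ ^ 2 / r)) := by ring
    _ ≤ (368640 * M * (θ ^ 2 / δ ^ 2) * B) * (4 * (614400 * M * (n + 1) * δ ^ 2 / r)) := by gcongr
    _ = 905969664000 * M ^ 2 * (n + 1) * θ ^ 2 * B / r := by field_simp; ring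
    _ ≤ _ := by gcongr; norm_num

/-! ### The choice of the stem -/

open Classical in
/-- Selection of a stem: if each point of `G` lies in between `ν` and `μ` of the sets `W T`, and
each tube through such a point has at least `κ` partners there at separation more than `θ`, then
some tube `T₀` meets many partners whose sets `W T` have measure at least `a`. -/
theorem exists_stem {θ a ν μ κ : ℝ} {𝒯 : Finset Tube} (h𝒯 : 𝒯.Nonempty) {W : Tube → Set R3}
    {G : Set R3} (hGm : MeasurableSet G) (hG : volume G ≠ ⊤)
    (hWm : ∀ T ∈ 𝒯, MeasurableSet (W T)) (hWG : ∀ T ∈ 𝒯, W T ⊆ G) (hκ : 0 ≤ κ)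
    (hμ : 0 ≤ μ) (ha0 : 0 ≤ a)
    (hlow : ∀ x ∈ G, ν ≤ ((𝒯.filter fun T => x ∈ W T).card : ℝ))
    (hup : ∀ x ∈ G, ((𝒯.filter fun T => x ∈ W T).card : ℝ) ≤ μ)
    (hpart : ∀ x ∈ G, ∀ T ∈ 𝒯.filter (fun T => x ∈ W T),
      κ ≤ (((𝒯.filter fun T => x ∈ W T).filter fun T' => θ < T.sep T').card : ℝ))
    (ha : 2 * (μ * a * 𝒯.card) ≤ ν * κ * volume.real G) :
    ∃ T₀ ∈ 𝒯, μ * a ≤ ∑ T ∈ 𝒯.filter (fun T => a ≤ volume.real (W T) ∧ θ < T₀.sep T),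
      volume.real (W T₀ ∩ W T) := by
  set Q : Finset (Tube × Tube) := (𝒯 ×ˢ 𝒯).filter fun p => θ < p.1.sep p.2 with hQ
  obtain ⟨V, hV⟩ : ∃ V : Tube × Tube → Set R3, ∀ p, V p = W p.1 ∩ W p.2 := ⟨_, fun _ => rfl⟩
  have hWfin : ∀ T ∈ 𝒯, volume (W T) ≠ ⊤ := fun T hT =>
    ((measure_mono (hWG T hT)).trans_lt hG.lt_top).ne
  have hVm : ∀ p ∈ Q, MeasurableSet (V p) := fun p hp => by
    have := Finset.mem_product.1 (Finset.mem_filter.1 hp).1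
    rw [hV]; exact (hWm _ this.1).inter (hWm _ this.2)
  have hVG : ∀ p ∈ Q, V p ∩ G = V p := fun p hp => by
    have := Finset.mem_product.1 (Finset.mem_filter.1 hp).1
    refine Set.inter_eq_left.2 ?_
    rw [hV]; exact Set.inter_subset_left.trans (hWG _ this.1)
  -- Each point of `G` lies in at least `ν` sets `W T`, each with `κ` partners there, so at least `ν
  -- κ` ordered transversal pairs pass through it.
  have hpairs : ν * κ * volume.real G ≤ ∑ p ∈ Q, volume.real (V p) := by
    have h := mul_measureReal_le_sum Q hG hGm hVm (a := ν * κ) fun x hx => ?_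
    · exact h.trans (le_of_eq (Finset.sum_congr rfl fun p hp => by rw [hVG p hp]))
    set S := 𝒯.filter fun T => x ∈ W T with hS
    have hsub : (S.sigma fun T => S.filter fun T' => θ < T.sep T').map
        ⟨fun q : (_ : Tube) × Tube => (q.1, q.2), fun q q' h => by
          obtain ⟨a, b⟩ := q; obtain ⟨c, d⟩ := q'; simpa using h⟩ ⊆
        Q.filter fun p => x ∈ V p := by
      intro p hp
      obtain ⟨⟨T, T'⟩, hq, rfl⟩ := Finset.mem_map.1 hp
      obtain ⟨hT, hT'⟩ := Finset.mem_sigma.1 hq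
      obtain ⟨hT', hθ⟩ := Finset.mem_filter.1 hT'
      have h1 := Finset.mem_filter.1 hT
      have h2 := Finset.mem_filter.1 hT'
      refine Finset.mem_filter.2 ⟨Finset.mem_filter.2 ⟨Finset.mem_product.2 ⟨h1.1, h2.1⟩, hθ⟩, ?_⟩
      rw [hV]; exact ⟨h1.2, h2.2⟩
    have hc := Finset.card_le_card hsub
    rw [Finset.card_map, Finset.card_sigma] at hc
    calc ν * κ ≤ S.card * κ := by gcongr; exact hlow x hx
      _ = ∑ _T ∈ S, κ := by rw [Finset.sum_const, nsmul_eq_mul]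
      _ ≤ ∑ T ∈ S, ((S.filter fun T' => θ < T.sep T').card : ℝ) :=
        Finset.sum_le_sum fun T hT => hpart x hx T hT
      _ ≤ _ := by exact_mod_cast hc
  -- Pairs whose second tube has `|W T| < a` contribute at most `μ a |𝒯|`, which is at most half of
  -- the total by `ha`. The remaining pairs are averaged over the first tube.
  have hsplit : ∑ p ∈ Q, volume.real (V p) ≤
      (∑ T₀ ∈ 𝒯, ∑ T ∈ 𝒯.filter (fun T => a ≤ volume.real (W T) ∧ θ < T₀.sep T),
        volume.real (W T₀ ∩ W T)) +
      ∑ T ∈ 𝒯.filter (fun T => ¬ a ≤ volume.real (W T)), ∑ T₀ ∈ 𝒯,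
        volume.real (W T₀ ∩ W T) := by
    rw [hQ, Finset.sum_filter, Finset.sum_product, Finset.sum_comm (s := Finset.filter _ _),
      ← Finset.sum_add_distrib]
    refine Finset.sum_le_sum fun T₀ _ => ?_
    rw [Finset.sum_filter, Finset.sum_filter, ← Finset.sum_add_distrib]
    refine Finset.sum_le_sum fun T _ => ?_
    rw [hV]
    have h0 : 0 ≤ volume.real (W T₀ ∩ W T) := measureReal_nonneg
    by_cases h1 : a ≤ volume.real (W T) <;> by_cases h2 : θ < T₀.sep T <;> simp [h1, h2, h0]
  have hbad : ∑ T ∈ 𝒯.filter (fun T => ¬ a ≤ volume.real (W T)), ∑ T₀ ∈ 𝒯,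
      volume.real (W T₀ ∩ W T) ≤ μ * a * 𝒯.card := by
    have h1 : ∀ T ∈ 𝒯.filter (fun T => ¬ a ≤ volume.real (W T)),
        ∑ T₀ ∈ 𝒯, volume.real (W T₀ ∩ W T) ≤ μ * a := by
      intro T hT
      obtain ⟨hT, hTa⟩ := Finset.mem_filter.1 hT
      refine (sum_le_mul_measureReal 𝒯 (hWfin T hT) (hWm T hT) hWm
        fun x hx => hup x (hWG T hT hx)).trans ?_
      have := (not_le.1 hTa).le
      gcongr
    refine (Finset.sum_le_sum h1).trans ?_
    rw [Finset.sum_const, nsmul_eq_mul, mul_comm]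
    gcongr
    exact Finset.filter_subset _ _
  have hgood : ∑ _T₀ ∈ 𝒯, μ * a ≤
      ∑ T₀ ∈ 𝒯, ∑ T ∈ 𝒯.filter (fun T => a ≤ volume.real (W T) ∧ θ < T₀.sep T),
        volume.real (W T₀ ∩ W T) := by
    rw [Finset.sum_const, nsmul_eq_mul]
    linarith
  exact Finset.exists_le_of_sum_le h𝒯 hgood

/-! ### Levels of multiplicity and pigeonholing -/

theorem measurableSet_multiplicityLevel {𝒯 : Finset Tube} {Y : Tube → Set R3}
    (hY : ∀ T ∈ 𝒯, MeasurableSet (Y T)) (μ : ℕ) : MeasurableSet (multiplicityLevel 𝒯 Y μ) :=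
  measurableSet_filter_mem 𝒯 hY fun σ => μ ≤ σ.card ∧ σ.card < 2 * μ

theorem multiplicityLevel_subset {𝒯 : Finset Tube} {Y : Tube → Set R3} {μ : ℕ} (hμ : 1 ≤ μ) :
    multiplicityLevel 𝒯 Y μ ⊆ ⋃ T ∈ 𝒯, Y T := by
  classical
  rintro x ⟨hx, -⟩
  obtain ⟨T, hT⟩ := Finset.card_pos.1 (hμ.trans hx)
  rw [Finset.mem_filter] at hT
  exact Set.mem_biUnion hT.1 hT.2

theorem volume_biUnion_ne_top {δ : ℝ} (hδ : 0 ≤ δ) {𝒯 : Finset Tube} {Y : Tube → Set R3}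
    (hYT : ∀ T ∈ 𝒯, Y T ⊆ T.carrier δ) : volume (⋃ T ∈ 𝒯, Y T) ≠ ⊤ :=
  (measure_biUnion_lt_top 𝒯.finite_toSet fun T hT =>
    (measure_mono (hYT T hT)).trans_lt (T.volume_carrier_ne_top hδ).lt_top).ne

theorem volume_multiplicityLevel_ne_top {δ : ℝ} (hδ : 0 ≤ δ) {𝒯 : Finset Tube}
    {Y : Tube → Set R3} (hYT : ∀ T ∈ 𝒯, Y T ⊆ T.carrier δ) {μ : ℕ} (hμ : 1 ≤ μ) :
    volume (multiplicityLevel 𝒯 Y μ) ≠ ⊤ :=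
  ((measure_mono (multiplicityLevel_subset hμ)).trans_lt
    (volume_biUnion_ne_top hδ hYT).lt_top).ne

theorem exists_measureReal_le_mul_fiber {X : Type*} [MeasurableSpace X] {μ : Measure X}
    {A : Set X} (f : X → ℕ) {n : ℕ} (hf : ∀ x ∈ A, f x ≤ n) :
    ∃ i ≤ n, μ.real A ≤ (n + 1) * μ.real {x ∈ A | f x = i} := by
  by_contra! hcon
  have hA : A = ⋃ i ∈ Finset.range (n + 1), {x ∈ A | f x = i} := by
    ext x
    simp only [Set.mem_iUnion, Finset.mem_range, Set.mem_ofPred_eq, exists_prop]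
    exact ⟨fun hx => ⟨f x, Nat.lt_succ_of_le (hf x hx), hx, rfl⟩, fun ⟨_, _, hx, _⟩ => hx⟩
  have h1 : μ.real A ≤ ∑ i ∈ Finset.range (n + 1), μ.real {x ∈ A | f x = i} := by
    conv_lhs => rw [hA]
    exact measureReal_biUnion_finset_le _ _
  have h2 : (n + 1) * ∑ i ∈ Finset.range (n + 1), μ.real {x ∈ A | f x = i} <
      (n + 1) * μ.real A := by
    rw [Finset.mul_sum]
    calc _ < ∑ _i ∈ Finset.range (n + 1), μ.real A :=
          Finset.sum_lt_sum_of_nonempty (by simp) fun i hi =>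
            hcon i (Nat.lt_succ_iff.1 (Finset.mem_range.1 hi))
      _ = _ := by rw [Finset.sum_const, Finset.card_range, nsmul_eq_mul]; push_cast; ring
  exact absurd (mul_le_mul_of_nonneg_left h1 (by positivity)) (not_le.2 h2)

/-! ### The bound for the multiplicity -/

/-- Here `h` is the number of tubes in the brush: `h1` bounds it below by intersections with the
stem, `h2` above by the hairbrush estimate. Eliminating it leaves one factor `θ ≤ 1` on the right.
The power `c ^ 4` collects `a ^ 3` and `r`. -/
theorem hairbrush_combine {K m n lam δ c μ θ d h r a : ℝ} (hK : 0 < K) (hm : 0 < m) (hn : 1 ≤ n)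
    (hlam : 0 < lam) (hδ : 0 < δ) (hc : 0 < c) (hμ : 0 < μ) (hθ : 0 < θ) (hθ1 : θ ≤ 1)
    (hd : 0 < d) (hr0 : 0 < r) (ha : a = c * (lam * δ ^ 2)) (hr : r = c * d / (16 * K ^ 2))
    (h1 : μ * a * θ ≤ 3 * δ ^ 3 * h)
    (h2 : μ / 2 * h * a ^ 2 ≤ 10 ^ 12 * (K * m) ^ 2 * (n + 1) * θ ^ 2 * (K * lam * δ ^ 2) / r) :
    (μ * lam) ^ 2 * c ^ 4 * (δ * d) ≤ 10 ^ 15 * K ^ 5 * m ^ 2 * n := by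
  have hcomb : (μ * a * θ) * (μ / 2 * a ^ 2) ≤
      3 * δ ^ 3 * (10 ^ 12 * (K * m) ^ 2 * (2 * n) * θ ^ 2 * (K * lam * δ ^ 2) / r) := by
    calc (μ * a * θ) * (μ / 2 * a ^ 2) ≤ (3 * δ ^ 3 * h) * (μ / 2 * a ^ 2) := by gcongr
      _ = 3 * δ ^ 3 * (μ / 2 * h * a ^ 2) := by ring
      _ ≤ 3 * δ ^ 3 * (10 ^ 12 * (K * m) ^ 2 * (n + 1) * θ ^ 2 * (K * lam * δ ^ 2) / r) := by
          gcongr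
      _ ≤ _ := by gcongr; linarith
  have hr' : 16 * K ^ 2 * r = c * d := by rw [hr]; field_simp
  have hfin : ((μ * lam) ^ 2 * c ^ 4 * (δ * d)) * (lam * δ ^ 5 * θ) ≤
      (192 * 10 ^ 12 * K ^ 5 * m ^ 2 * n * θ) * (lam * δ ^ 5 * θ) := by
    calc ((μ * lam) ^ 2 * c ^ 4 * (δ * d)) * (lam * δ ^ 5 * θ)
        = (μ * a * θ) * (μ / 2 * a ^ 2) * (2 * (c * d)) := by rw [ha]; ring
      _ = (μ * a * θ) * (μ / 2 * a ^ 2) * (32 * K ^ 2 * r) := by rw [← hr']; ring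
      _ ≤ 3 * δ ^ 3 * (10 ^ 12 * (K * m) ^ 2 * (2 * n) * θ ^ 2 * (K * lam * δ ^ 2) / r) *
          (32 * K ^ 2 * r) := by gcongr
      _ = 3 * δ ^ 3 * (10 ^ 12 * (K * m) ^ 2 * (2 * n) * θ ^ 2 * (K * lam * δ ^ 2)) *
          (32 * K ^ 2) * (r / r) := by ring
      _ = _ := by rw [div_self hr0.ne']; ring
  refine (le_of_mul_le_mul_right hfin (by positivity)).trans ?_
  calc 192 * 10 ^ 12 * K ^ 5 * m ^ 2 * n * θ ≤ 10 ^ 15 * K ^ 5 * m ^ 2 * n * 1 := by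
        gcongr; norm_num
    _ = _ := by ring

open Classical in
/-- A multiplicity level that carries a fraction `η` of the mass of the shadings has the
multiplicity of a hairbrush. -/
theorem multiplicity_bound {K ε ε' δ m lam η c : ℝ} (hK : 1 ≤ K) (hε : 0 < ε) (hε' : ε' < ε)
    (hδ : 0 < δ) (hδ1 : δ < 1) {n : ℕ} (hn : 4 < 2 ^ n * δ) (hn' : 2 ^ n * δ ≤ 8) (hm : 1 ≤ m)
    (hlam : 0 < lam) (hlam1 : lam < 1) {𝒯 : Finset Tube} {Y : Tube → Set R3}
    (hsep : DirectionsSeparated δ 𝒯) (hpar : ParallelAtMost (K * m) 𝒯)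
    (hsh : ∀ T ∈ 𝒯, IsShadingOfDensity K δ lam T (Y T))
    (htwo : ∀ T ∈ 𝒯, IsTwoEnds K ε ε' δ T (Y T)) (h𝒯 : 𝒯.Nonempty) {μ : ℕ} (hμ : 1 ≤ μ)
    (hη : 0 < η) (hη1 : η ≤ 1)
    (hmass : η * (lam * (δ ^ 2 * (𝒯.card : ℝ))) ≤ μ * volume.real (multiplicityLevel 𝒯 Y μ))
    (hc : c = η / (32 * (n : ℝ) ^ 2)) (hsmall : 8 * K ^ 2 * δ ^ ε' ≤ c) :
    (μ * lam) ^ 2 * c ^ 4 * (δ * δ ^ (ε - ε')) ≤ 10 ^ 15 * K ^ 5 * m ^ 2 * n := by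
  have hK0 : 0 < K := by linarith
  have hm0 : 0 < m := by linarith
  have hμ0 : (1 : ℝ) ≤ μ := by exact_mod_cast hμ
  have hn0 : 0 < n := Nat.pos_of_ne_zero fun h => by rw [h] at hn; norm_num at hn; linarith
  have hn1 : (1 : ℝ) ≤ n := by exact_mod_cast hn0
  have hc0 : 0 < c := by rw [hc]; positivity
  have hc1 : c ≤ 1 := by
    rw [hc, div_le_one (by positivity)]; nlinarith
  have hδε : δ ^ (ε - ε') ≤ 1 := Real.rpow_le_one hδ.le hδ1.le (by linarith)
  have hδε0 : 0 < δ ^ (ε - ε') := by positivity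
  have hYT : ∀ T ∈ 𝒯, Y T ⊆ T.carrier δ := fun T hT => (hsh T hT).1
  have hYm : ∀ T ∈ 𝒯, MeasurableSet (Y T) := fun T hT => (hsh T hT).2.1
  have hYB : ∀ T ∈ 𝒯, volume.real (Y T) ≤ K * lam * δ ^ 2 := fun T hT =>
    (hsh T hT).2.2.2.trans (by
      rw [mul_assoc]
      have := T.volume_real_carrier_le hδ.le
      gcongr)
  have hNpos : (0 : ℝ) < 𝒯.card := by exact_mod_cast h𝒯.card_pos
  set A := multiplicityLevel 𝒯 Y μ with hA
  have hAfin : volume A ≠ ⊤ := volume_multiplicityLevel_ne_top hδ.le hYT hμ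
  have hApos : 0 < volume.real A := by
    have : 0 < μ * volume.real A := lt_of_lt_of_le (by positivity) hmass
    exact pos_of_mul_pos_right this (by positivity)
  -- The cluster and its scale depend only on the finite set of tubes through a point. This makes
  -- the sets `G` and `W T` below measurable, by `measurableSet_filter_mem`.
  choose I hI S' hS' hcard hdiam hpart using exists_spread_cluster n
  let tubes : R3 → Finset Tube := fun x => 𝒯.filter fun T => x ∈ Y T
  obtain ⟨i, hin, hAi⟩ := exists_measureReal_le_mul_fiber (μ := volume) (A := A)
    (fun x => I (tubes x)) (n := n) (fun x _ => hI _)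
  set G := {x ∈ A | I (tubes x) = i} with hG
  have hGm : MeasurableSet G := measurableSet_filter_mem 𝒯 hYm
    fun σ => (μ ≤ σ.card ∧ σ.card < 2 * μ) ∧ I σ = i
  have hGA : G ⊆ A := fun x hx => hx.1
  have hGfin : volume G ≠ ⊤ := ((measure_mono hGA).trans_lt hAfin.lt_top).ne
  have htub : ∀ x ∈ G, (μ : ℝ) ≤ (tubes x).card ∧ ((tubes x).card : ℝ) ≤ 2 * μ := by
    intro x hx
    have h1 : μ ≤ (tubes x).card := hx.1.1
    have h2 : (tubes x).card < 2 * μ := hx.1.2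
    exact ⟨by exact_mod_cast h1, by exact_mod_cast h2.le⟩
  have hhalf : ∀ x ∈ G, (μ : ℝ) / 2 ≤ (S' (tubes x)).card := by
    intro x hx
    refine le_trans ?_ (hcard (tubes x))
    have h1 : (I (tubes x) : ℝ) / (2 * n) ≤ 1 / 2 := by
      rw [div_le_iff₀ (by positivity)]
      have : (I (tubes x) : ℝ) ≤ n := by exact_mod_cast hI _
      linarith
    nlinarith [(htub x hx).1]
  -- At the finest scale `i = n` a cluster has diameter at most `4 * 2 ^ (-n) < δ`, so its tubes are
  -- parallel and `μ ≤ 2 K m`.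
  rcases hin.lt_or_eq with hin | hin
  swap
  · obtain ⟨x, hx⟩ : G.Nonempty := by
      by_contra h
      rw [Set.not_nonempty_iff_eq_empty.1 h, measureReal_empty] at hAi
      linarith
    have hcn : (S' (tubes x)).card ≤ K * m := by
      obtain ⟨T, hT⟩ : (S' (tubes x)).Nonempty := by
        rw [← Finset.card_pos]
        have := hhalf x hx
        exact_mod_cast (show (0 : ℝ) < (S' (tubes x)).card by linarith)
      have hmem : ∀ T ∈ S' (tubes x), T ∈ 𝒯 := fun T hT =>
        (Finset.mem_filter.1 (hS' _ hT)).1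
      refine le_trans (Nat.cast_le.2 (Finset.card_le_card fun T' hT' => ?_)) (hpar T (hmem T hT))
      refine Finset.mem_filter.2 ⟨hmem T' hT', hsep.parallel_of_sep_lt (hmem T hT) (hmem T' hT') ?_⟩
      refine (hdiam _ T hT T' hT').trans_lt ?_
      rw [hx.2, hin, one_div, inv_pow, ← div_eq_mul_inv, div_lt_iff₀ (by positivity)]
      linarith
    have hμKm : (μ : ℝ) ≤ 2 * (K * m) := by linarith [hhalf x hx]
    calc (μ * lam) ^ 2 * c ^ 4 * (δ * δ ^ (ε - ε'))
        ≤ (2 * (K * m) * 1) ^ 2 * 1 ^ 4 * (1 * 1) := by gcongr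
      _ = 4 * K ^ 2 * m ^ 2 * 1 := by ring
      _ ≤ 10 ^ 15 * K ^ 5 * m ^ 2 * n := by gcongr <;> norm_num
  set θ : ℝ := (1 / 2) ^ i with hθ
  have hθ0 : 0 < θ := by positivity
  have hθ1 : θ ≤ 1 := pow_le_one₀ (by norm_num) (by norm_num)
  have hδθ : δ ≤ 4 * θ := by
    have h1 : (1 / 2 : ℝ) ^ n * 2 ≤ θ := by
      have : (1 / 2 : ℝ) ^ n ≤ (1 / 2) ^ (i + 1) :=
        pow_le_pow_of_le_one (by norm_num) (by norm_num) hin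
      rw [pow_succ] at this; linarith
    have h2 : δ = 2 ^ n * δ * (1 / 2) ^ n := by
      rw [mul_right_comm, ← mul_pow]; norm_num
    have h3 : 0 < (1 / 2 : ℝ) ^ n := by positivity
    nlinarith
  -- `W T` keeps the points at which `T` belongs to the selected cluster.
  obtain ⟨W, hW⟩ : ∃ W : Tube → Set R3, ∀ T, W T = {x ∈ G | T ∈ S' (tubes x)} :=
    ⟨_, fun _ => rfl⟩
  have hWG : ∀ T, ∀ x ∈ W T, x ∈ G ∧ T ∈ S' (tubes x) := fun T x hx => by
    rw [hW] at hx; exact hx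
  have hWm : ∀ T ∈ 𝒯, MeasurableSet (W T) := fun T _ => by
    rw [hW]
    exact measurableSet_filter_mem 𝒯 hYm
      fun σ => ((μ ≤ σ.card ∧ σ.card < 2 * μ) ∧ I σ = i) ∧ T ∈ S' σ
  have hWY : ∀ T ∈ 𝒯, W T ⊆ Y T := fun T _ x hx =>
    (Finset.mem_filter.1 (hS' _ (hWG T x hx).2)).2
  have hWfil : ∀ x ∈ G, (𝒯.filter fun T => x ∈ W T) = S' (tubes x) := by
    intro x hx
    ext T
    rw [Finset.mem_filter]
    exact ⟨fun h => (hWG T x h.2).2,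
      fun h => ⟨(Finset.mem_filter.1 (hS' _ h)).1, by rw [hW]; exact ⟨hx, h⟩⟩⟩
  set a := c * (lam * δ ^ 2) with ha
  have ha0 : 0 < a := by positivity
  -- The two factors `n` in `c` pay for the pigeonholing of the scale and for the number `μ / (2 n)`
  -- of partners.
  have hstem : 2 * (2 * μ * a * 𝒯.card) ≤ (μ : ℝ) / 2 * (μ / (2 * n)) * volume.real G := by
    have h1 : (n + 1 : ℝ) * volume.real G ≤ 2 * n * volume.real G := by
      gcongr; linarith
    have h2 : η * (lam * (δ ^ 2 * 𝒯.card)) ≤ μ * (2 * n * volume.real G) :=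
      hmass.trans (by gcongr; exact hAi.trans h1)
    have h3 : 2 * (2 * μ * a * 𝒯.card) = μ / (8 * n ^ 2) * (η * (lam * (δ ^ 2 * 𝒯.card))) := by
      rw [ha, hc]; field_simp; ring
    rw [h3]
    calc _ ≤ μ / (8 * n ^ 2) * (μ * (2 * n * volume.real G)) := by gcongr
      _ = _ := by field_simp; ring
  obtain ⟨T₀, hT₀, hsum⟩ := exists_stem (θ := θ) h𝒯 (W := W) hGm hGfin hWm
    (fun T _ x hx => (hWG T x hx).1) (κ := (μ : ℝ) / (2 * n)) (ν := (μ : ℝ) / 2) (by positivity)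
    (μ := 2 * μ) (by positivity) ha0.le
    (fun x hx => by rw [hWfil x hx]; exact hhalf x hx)
    (fun x hx => by
      rw [hWfil x hx]
      exact le_trans (Nat.cast_le.2 (Finset.card_le_card (hS' _))) (htub x hx).2)
    (fun x hx T hT => by
      rw [hWfil x hx] at hT ⊢
      have := hpart (tubes x) (by rw [hx.2]; exact hin) T hT
      rw [hx.2] at this
      refine le_trans ?_ this
      gcongr
      exact_mod_cast (htub x hx).1) hstem
  set H₀ := 𝒯.filter fun T => a ≤ volume.real (W T) ∧ θ < T₀.sep T with hH₀
  set H := H₀.filter fun T => (W T₀ ∩ W T).Nonempty with hH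
  have hHmem : ∀ T ∈ H, T ∈ 𝒯 ∧ a ≤ volume.real (W T) ∧ θ < T₀.sep T ∧
      (W T₀ ∩ W T).Nonempty := fun T hT => by
    obtain ⟨h1, h2⟩ := Finset.mem_filter.1 hT
    obtain ⟨h3, h4⟩ := Finset.mem_filter.1 h1
    exact ⟨h3, h4.1, h4.2, h2⟩
  have hHcard : 2 * μ * a ≤ H.card * (6 * δ ^ 3 / θ) := by
    refine hsum.trans ?_
    rw [← Finset.sum_subset (Finset.filter_subset _ _ : H ⊆ H₀) fun T hT hTn => by
      have : ¬ (W T₀ ∩ W T).Nonempty := fun h => hTn (Finset.mem_filter.2 ⟨hT, h⟩)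
      rw [Set.not_nonempty_iff_eq_empty.1 this, measureReal_empty]]
    rw [← nsmul_eq_mul, ← Finset.sum_const]
    refine Finset.sum_le_sum fun T hT => ?_
    obtain ⟨hT𝒯, -, hTθ, -⟩ := hHmem T hT
    have hs : 0 < T₀.sep T := hθ0.trans hTθ
    refine (measureReal_mono (Set.inter_subset_inter ((hWY T₀ hT₀).trans (hYT T₀ hT₀))
      ((hWY T hT𝒯).trans (hYT T hT𝒯))) ?_).trans
      ((Tube.volume_real_inter_le hδ.le hs).trans (by gcongr))
    exact ((measure_mono Set.inter_subset_left).trans_lt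
      (T₀.volume_carrier_ne_top hδ.le).lt_top).ne
  -- With this `r` the first term of the two-ends bound for a window is `a / 4`; `hsmall` makes the
  -- second at most `a / 4` as well.
  set r := c * δ ^ (ε - ε') / (16 * K ^ 2) with hr
  have hr0 : 0 < r := by positivity
  have hr1 : r ≤ 1 := by
    rw [hr, div_le_one (by positivity)]
    nlinarith
  have hbrush := hairbrush_card_le hδ hn hn' (fun T hT => (hHmem T hT).1 : H ⊆ 𝒯) hsep hpar
    (by positivity) hr0 hr1 hδθ ha0.le (ν := (μ : ℝ) / 2) (by positivity)
    (B := K * lam * δ ^ 2) (by positivity) (T₀ := T₀) hYm hYB hYT hWm hWY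
    (fun T hT => (hHmem T hT).2.1)
    (fun T hT => by
      obtain ⟨x, hx₀, hx⟩ := (hHmem T hT).2.2.2
      exact ⟨x, hYT _ hT₀ (hWY _ hT₀ hx₀), hYT _ (hHmem T hT).1 (hWY _ (hHmem T hT).1 hx)⟩)
    (fun T hT h => by
      have hT𝒯 := (hHmem T hT).1
      have hYfin : volume (Y T) ≠ ⊤ :=
        ((measure_mono (hYT T hT𝒯)).trans_lt (T.volume_carrier_ne_top hδ.le).lt_top).ne
      have h1 : volume.real {y ∈ W T | |T.height y - h| ≤ r} ≤
          volume.real {y ∈ Y T | |T.height y - h| ≤ r} :=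
        measureReal_mono (fun y hy => ⟨hWY T hT𝒯 hy.1, hy.2⟩)
          ((measure_mono (fun y hy => hy.1)).trans_lt hYfin.lt_top).ne
      refine h1.trans (((htwo T hT𝒯).volume_window_le hK hε hδ hδ1 (hYT T hT𝒯) (hYm T hT𝒯) h
        hr0.le).trans ?_)
      have h2 : δ ^ (ε - ε') * δ ^ (-ε) * δ ^ ε' = 1 := by
        rw [← Real.rpow_add hδ, ← Real.rpow_add hδ, show ε - ε' + -ε + ε' = 0 by ring,
          Real.rpow_zero]
      calc (4 * r * δ ^ (-ε) + 2) * (K * volume.real (Y T) * δ ^ ε')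
          ≤ (4 * r * δ ^ (-ε) + 2) * (K * (K * lam * δ ^ 2) * δ ^ ε') := by
            have := hYB T hT𝒯
            gcongr
        _ = (c / 4 * (δ ^ (ε - ε') * δ ^ (-ε) * δ ^ ε') + 8 * K ^ 2 * δ ^ ε' / 4) *
            (lam * δ ^ 2) := by rw [hr]; field_simp; ring
        _ ≤ (c / 4 * 1 + c / 4) * (lam * δ ^ 2) := by rw [h2]; gcongr
        _ = a / 2 := by rw [ha]; ring)
    -- At a point common to `T₀` and `T` the cluster shows that they are `4 θ`-close. The cluster at
    -- `y`, of at least `μ / 2` tubes, is `4 θ`-close to `T`, hence `8 θ`-close to the stem.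
    (fun T hT y hy => by
      have hy := hWG T y hy
      refine (hhalf y hy.1).trans (Nat.cast_le.2 (Finset.card_le_card fun T' hT' => ?_))
      have hT'2 := Finset.mem_filter.1 (hS' _ hT')
      refine Finset.mem_filter.2 ⟨Finset.mem_filter.2 ⟨hT'2.1, ?_⟩, hT'2.2⟩
      obtain ⟨x, hx₀, hx⟩ := (hHmem T hT).2.2.2
      have hx₀ := hWG T₀ x hx₀
      have hx := hWG T x hx
      have h1 := hdiam _ T₀ hx₀.2 T hx.2
      have h2 := hdiam _ T hy.2 T' hT'
      rw [hx.1.2] at h1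
      rw [hy.1.2] at h2
      linarith [T₀.sep_triangle T T'])
  have hH2 : μ * a * θ ≤ 3 * δ ^ 3 * H.card := by
    have := mul_le_mul_of_nonneg_right hHcard hθ0.le
    rw [mul_div_assoc', div_mul_cancel₀ _ hθ0.ne'] at this
    linarith
  exact hairbrush_combine hK0 hm0 hn1 hlam hδ hc0 (by positivity) hθ0 hθ1 hδε0 hr0 ha hr hH2 hbrush

/-! ### Logarithmic losses and large `δ` -/

theorem exists_dyadic_scale {δ : ℝ} (hδ : 0 < δ) (hδ1 : δ < 1) :
    ∃ n : ℕ, 4 < 2 ^ n * δ ∧ 2 ^ n * δ ≤ 8 := by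
  obtain ⟨k, h1, h2⟩ := exists_nat_pow_near (x := 4 / δ) (y := (2 : ℝ))
    ((one_le_div hδ).2 (by linarith)) (by norm_num)
  refine ⟨k + 1, (div_lt_iff₀ hδ).1 h2, ?_⟩
  have := (le_div_iff₀ hδ).1 h1
  rw [pow_succ]; linarith

theorem natCast_le_rpow_of_pow_le {δ γ : ℝ} (hδ : 0 < δ) (hγ : 0 < γ) {n : ℕ}
    (hn : 2 ^ n * δ ≤ 8) : (n : ℝ) ≤ 8 ^ γ / (γ * Real.log 2) * δ ^ (-γ) := by
  have hlog2 : 0 < Real.log 2 := Real.log_pos (by norm_num)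
  have h1 : (2 : ℝ) ^ n ≤ 8 / δ := (le_div_iff₀ hδ).2 hn
  have h2 := Real.log_le_log (by positivity) h1
  rw [Real.log_pow] at h2
  have h3 := Real.log_le_rpow_div (show 0 ≤ 8 / δ by positivity) hγ
  rw [Real.div_rpow (by norm_num) hδ.le] at h3
  rw [Real.rpow_neg hδ.le]
  calc (n : ℝ) = n * Real.log 2 / Real.log 2 := by field_simp
    _ ≤ 8 ^ γ / δ ^ γ / γ / Real.log 2 := by gcongr; exact h2.trans h3
    _ = _ := by field_simp

theorem card_tubes_le {δ M : ℝ} (hδ : 0 < δ) (hδ1 : δ < 1) {𝒯 : Finset Tube}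
    (hsep : DirectionsSeparated δ 𝒯) (hpar : ParallelAtMost M 𝒯) (hM : 0 ≤ M) :
    (𝒯.card : ℝ) ≤ 23040 * M / δ ^ 2 := by
  classical
  rcases 𝒯.eq_empty_or_nonempty with h | ⟨T₀, -⟩
  · rw [h]; simp; positivity
  have h1 := card_cap_le hδ zero_le_two hsep hpar hM T₀
  rw [Finset.filter_true_of_mem fun T _ => T₀.sep_le_two T] at h1
  have h2 : 2 / δ + 1 ≤ 3 / δ := by
    have := (one_le_div hδ).2 hδ1.le
    rw [show (3 : ℝ) / δ = 2 / δ + 1 / δ by ring]; linarith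
  calc (𝒯.card : ℝ) ≤ 2560 * M * (2 / δ + 1) * (2 / δ + 1) := h1
    _ ≤ 2560 * M * (3 / δ) * (3 / δ) := by gcongr
    _ = _ := by field_simp; ring

/-- The multiplicity bound, with the logarithmic losses absorbed into a power `δ ^ (-β)`. -/
theorem exists_multiplicity_const {K ε ε' q β : ℝ} (hK : 1 ≤ K) (hε'0 : 0 < ε') (hε' : ε' < ε)
    (hq : 1 ≤ q) (hβ : 0 < β) :
    ∃ C : ℝ, 1 ≤ C ∧ ∀ (δ : ℝ) (n : ℕ), 0 < δ → δ < 1 → 4 < 2 ^ n * δ → 2 ^ n * δ ≤ 8 →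
      (n : ℝ) ≤ C * δ ^ (-β) ∧
      ∀ (m lam : ℝ), 1 ≤ m → 0 < lam → lam < 1 → ∀ (𝒯 : Finset Tube) (Y : Tube → Set R3),
      DirectionsSeparated δ 𝒯 → ParallelAtMost (K * m) 𝒯 →
      (∀ T ∈ 𝒯, IsShadingOfDensity K δ lam T (Y T)) →
      (∀ T ∈ 𝒯, IsTwoEnds K ε ε' δ T (Y T)) → 𝒯.Nonempty → ∀ μ : ℕ, 1 ≤ μ →
      lam * (δ ^ 2 * (𝒯.card : ℝ)) ≤ q * n * (μ * volume.real (multiplicityLevel 𝒯 Y μ)) →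
      μ * lam ≤ C * δ ^ (-(β + (ε - ε') / 2)) * (δ ^ (-(1 / 2) : ℝ) * m) := by
  have hlog2 : 0 < Real.log 2 := Real.log_pos (by norm_num)
  have hε : 0 < ε := hε'0.trans hε'
  let L : ℝ → ℝ := fun γ => 8 ^ γ / (γ * Real.log 2)
  have hL : ∀ γ, 0 < γ → 0 < L γ := fun γ hγ => by positivity
  -- Since `c⁻¹ = 32 q n³`, the bound for `(μ λ)²` contains `n * (n³)⁴ = n ^ 13`. Estimating `n`
  -- with exponent `2 β / 13` turns this into `δ ^ (-2 β)`, whose square root is the permitted loss.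
  set D : ℝ := 10 ^ 15 * K ^ 5 * (32 * q) ^ 4 * L (2 * β / 13) ^ 13 with hD
  have hD0 : 0 < D := by
    have := hL (2 * β / 13) (by positivity)
    positivity
  set B : ℝ := 256 * K ^ 2 * q * L (ε' / 6) ^ 3 with hB
  have hB0 : 0 < B := by
    have := hL (ε' / 6) (by positivity)
    positivity
  refine ⟨1 + L β + √D + 23040 * K * B ^ (4 / ε'), ?_, ?_⟩
  · have := hL β hβ
    have h1 : 0 ≤ 23040 * K * B ^ (4 / ε') := by positivity
    linarith [Real.sqrt_nonneg D]
  intro δ n hδ hδ1 hn hn'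
  have hrest : 0 ≤ 23040 * K * B ^ (4 / ε') := by positivity
  have hLβ := hL β hβ
  have hsq := Real.sqrt_nonneg D
  refine ⟨(natCast_le_rpow_of_pow_le hδ hβ hn').trans ?_, ?_⟩
  · gcongr
    change L β ≤ _
    linarith
  intro m lam hm hlam hlam1 𝒯 Y hsep hpar hsh htwo h𝒯 μ hμ hmass
  have hm0 : 0 < m := by linarith
  have hn0 : 0 < n := Nat.pos_of_ne_zero fun h => by rw [h] at hn; norm_num at hn; linarith
  have hn1 : (1 : ℝ) ≤ n := by exact_mod_cast hn0
  have hN : (0 : ℝ) < 𝒯.card := by exact_mod_cast h𝒯.card_pos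
  set X := δ ^ (-(β + (ε - ε') / 2)) * (δ ^ (-(1 / 2) : ℝ) * m) with hX
  have hX0 : 0 < X := by positivity
  have hgoal : ∀ c, c * δ ^ (-(β + (ε - ε') / 2)) * (δ ^ (-(1 / 2) : ℝ) * m) = c * X :=
    fun c => by rw [hX]; ring
  rw [hgoal]
  set c : ℝ := 1 / (q * n) / (32 * (n : ℝ) ^ 2) with hc
  have hcn : c⁻¹ = 32 * q * n ^ 3 := by rw [hc]; field_simp
  have hc0 : 0 < c := by positivity
  rcases le_or_gt (8 * K ^ 2 * δ ^ ε') c with hsmall | hbig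
  · have hb := multiplicity_bound hK hε hε' hδ hδ1 hn hn' hm hlam hlam1 hsep hpar hsh htwo h𝒯 hμ
      (η := 1 / (q * n)) (by positivity)
      (by rw [div_le_one (by positivity)]; nlinarith)
      (by rw [one_div, inv_mul_le_iff₀ (by positivity)]; exact hmass) hc hsmall
    have h13 : (n : ℝ) ^ 13 ≤ L (2 * β / 13) ^ 13 * δ ^ (-(2 * β)) := by
      have h := pow_le_pow_left₀ (by positivity)
        (natCast_le_rpow_of_pow_le hδ (γ := 2 * β / 13) (by positivity) hn') 13
      rwa [mul_pow, ← Real.rpow_mul_natCast hδ.le,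
        show -(2 * β / 13) * ((13 : ℕ) : ℝ) = -(2 * β) by push_cast; ring] at h
    have hXsq : X ^ 2 = δ ^ (-(2 * β)) * (δ * δ ^ (ε - ε'))⁻¹ * m ^ 2 := by
      have e1 : (δ ^ (-(β + (ε - ε') / 2))) ^ 2 = δ ^ (-(2 * β)) * (δ ^ (ε - ε'))⁻¹ := by
        rw [← Real.rpow_mul_natCast hδ.le, ← Real.rpow_neg hδ.le, ← Real.rpow_add hδ]
        congr 1; push_cast; ring
      have e2 : (δ ^ (-(1 / 2) : ℝ)) ^ 2 = δ⁻¹ := by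
        rw [← Real.rpow_mul_natCast hδ.le, ← Real.rpow_neg_one]
        congr 1; norm_num
      rw [hX, mul_pow, mul_pow, e1, e2, mul_inv]; ring
    have hsqle : (μ * lam) ^ 2 ≤ (√D * X) ^ 2 := by
      rw [mul_pow (√D), Real.sq_sqrt hD0.le, hXsq]
      have hp : 0 < c ^ 4 * (δ * δ ^ (ε - ε')) := by positivity
      have h1 : (μ * lam) ^ 2 ≤ 10 ^ 15 * K ^ 5 * m ^ 2 * n / (c ^ 4 * (δ * δ ^ (ε - ε'))) := by
        rw [le_div_iff₀ hp]; linarith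
      refine h1.trans ?_
      rw [div_eq_mul_inv, mul_inv, ← inv_pow, hcn]
      calc 10 ^ 15 * K ^ 5 * m ^ 2 * n * ((32 * q * n ^ 3) ^ 4 * (δ * δ ^ (ε - ε'))⁻¹)
          = 10 ^ 15 * K ^ 5 * (32 * q) ^ 4 * n ^ 13 * ((δ * δ ^ (ε - ε'))⁻¹ * m ^ 2) := by ring
        _ ≤ 10 ^ 15 * K ^ 5 * (32 * q) ^ 4 * (L (2 * β / 13) ^ 13 * δ ^ (-(2 * β))) *
            ((δ * δ ^ (ε - ε'))⁻¹ * m ^ 2) := by gcongr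
        _ = _ := by rw [hD]; ring
    have h := abs_le_of_sq_le_sq' hsqle (by positivity) |>.2
    refine h.trans ?_
    gcongr
    linarith
  -- Here `δ ^ ε'` is at least a constant times `n ^ (-3)`, while `n³ ≲ δ ^ (-ε' / 2)`. So `δ` is
  -- bounded below, and bounding `μ` by the number of tubes is enough.
  · have hδB : δ ^ (-(ε' / 2)) ≤ B := by
      have h3 : (n : ℝ) ^ 3 ≤ L (ε' / 6) ^ 3 * δ ^ (-(ε' / 2)) := by
        have h := pow_le_pow_left₀ (by positivity)
          (natCast_le_rpow_of_pow_le hδ (γ := ε' / 6) (by positivity) hn') 3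
        rwa [mul_pow, ← Real.rpow_mul_natCast hδ.le,
          show -(ε' / 6) * ((3 : ℕ) : ℝ) = -(ε' / 2) by push_cast; ring] at h
      have h1 : 1 ≤ 8 * K ^ 2 * δ ^ ε' * (32 * q * n ^ 3) := by
        rw [← hcn, ← div_eq_mul_inv, le_div_iff₀ hc0]; linarith
      have h2 : δ ^ (-(ε' / 2)) * (δ ^ ε' * δ ^ (-(ε' / 2))) = 1 := by
        rw [← Real.rpow_add hδ, ← Real.rpow_add hδ,
          show -(ε' / 2) + (ε' + -(ε' / 2)) = 0 by ring, Real.rpow_zero]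
      calc δ ^ (-(ε' / 2)) = δ ^ (-(ε' / 2)) * 1 := by ring
        _ ≤ δ ^ (-(ε' / 2)) *
            (8 * K ^ 2 * δ ^ ε' * (32 * q * (L (ε' / 6) ^ 3 * δ ^ (-(ε' / 2))))) := by
            gcongr
            exact h1.trans (by gcongr)
        _ = B * (δ ^ (-(ε' / 2)) * (δ ^ ε' * δ ^ (-(ε' / 2)))) := by rw [hB]; ring
        _ = B := by rw [h2, mul_one]
    have hδ2 : (δ ^ 2)⁻¹ ≤ B ^ (4 / ε') := by
      have h := Real.rpow_le_rpow (by positivity) hδB (show 0 ≤ 4 / ε' by positivity)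
      rw [← Real.rpow_mul hδ.le, show -(ε' / 2) * (4 / ε') = -2 by field_simp; norm_num,
        Real.rpow_neg hδ.le, Real.rpow_two] at h
      exact h
    have hμN : (μ : ℝ) ≤ 𝒯.card := by
      have hne : (multiplicityLevel 𝒯 Y μ).Nonempty := by
        by_contra h
        rw [Set.not_nonempty_iff_eq_empty.1 h, measureReal_empty, mul_zero, mul_zero] at hmass
        have : 0 < lam * (δ ^ 2 * (𝒯.card : ℝ)) := by positivity
        linarith
      obtain ⟨x, hx, -⟩ := hne
      classical
      exact_mod_cast hx.trans (Finset.card_filter_le _ _)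
    have hX1 : m ≤ X := by
      have e1 : 1 ≤ δ ^ (-(β + (ε - ε') / 2)) :=
        Real.one_le_rpow_of_pos_of_le_one_of_nonpos hδ hδ1.le (by linarith)
      have e2 : 1 ≤ δ ^ (-(1 / 2) : ℝ) :=
        Real.one_le_rpow_of_pos_of_le_one_of_nonpos hδ hδ1.le (by norm_num)
      calc m = 1 * (1 * m) := by ring
        _ ≤ X := by rw [hX]; gcongr
    calc (μ : ℝ) * lam ≤ 𝒯.card * 1 := by gcongr
      _ ≤ 23040 * (K * m) / δ ^ 2 * 1 := by
          gcongr
          exact card_tubes_le hδ hδ1 hsep hpar (by positivity)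
      _ = 23040 * K * (δ ^ 2)⁻¹ * m := by ring
      _ ≤ 23040 * K * B ^ (4 / ε') * X := by gcongr
      _ ≤ _ := by gcongr; linarith

/-! ### Dyadic decomposition of the mass -/

open Classical in
/-- The dyadic decomposition of the mass of the shadings by multiplicity. -/
theorem sum_le_dyadic {δ : ℝ} (hδ : 0 ≤ δ) {𝒯 : Finset Tube} {Y : Tube → Set R3}
    (hYT : ∀ T ∈ 𝒯, Y T ⊆ T.carrier δ) (hYm : ∀ T ∈ 𝒯, MeasurableSet (Y T)) (k₀ J : ℕ)
    (hJ : ∀ x, coverCount 𝒯 Y x < 2 ^ (k₀ + J)) :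
    ∑ T ∈ 𝒯, volume.real (Y T) ≤
      2 ^ k₀ * volume.real {x ∈ ⋃ T ∈ 𝒯, Y T | coverCount 𝒯 Y x < 2 ^ k₀} +
      ∑ j ∈ Finset.range J,
        2 * (((2 ^ (k₀ + j) : ℕ) : ℝ) * volume.real (multiplicityLevel 𝒯 Y (2 ^ (k₀ + j)))) := by
  set U := ⋃ T ∈ 𝒯, Y T with hU
  have hUfin := volume_biUnion_ne_top hδ hYT
  have hUm : MeasurableSet U := Finset.measurableSet_biUnion _ hYm
  set Low := {x ∈ U | coverCount 𝒯 Y x < 2 ^ k₀} with hLow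
  have hLowm : MeasurableSet Low :=
    hUm.inter (measurableSet_filter_mem 𝒯 hYm fun σ => σ.card < 2 ^ k₀)
  have hLowfin : volume Low ≠ ⊤ := ((measure_mono fun x hx => hx.1).trans_lt hUfin.lt_top).ne
  have hYfin : ∀ T ∈ 𝒯, volume (Y T) ≠ ⊤ := fun T hT =>
    ((measure_mono (hYT T hT)).trans_lt (T.volume_carrier_ne_top hδ).lt_top).ne
  have hcov : ∀ T ∈ 𝒯, Y T ⊆ (Y T ∩ Low) ∪
      ⋃ j ∈ Finset.range J, Y T ∩ multiplicityLevel 𝒯 Y (2 ^ (k₀ + j)) := by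
    intro T hT x hx
    have hxU : x ∈ U := Set.mem_biUnion hT hx
    rcases lt_or_ge (coverCount 𝒯 Y x) (2 ^ k₀) with h | h
    · exact Or.inl ⟨hx, hxU, h⟩
    right
    have hpos : coverCount 𝒯 Y x ≠ 0 := (lt_of_lt_of_le (by positivity) h).ne'
    set l := Nat.log 2 (coverCount 𝒯 Y x) with hl
    have h1 : 2 ^ l ≤ coverCount 𝒯 Y x := Nat.pow_log_le_self 2 hpos
    have h2 : coverCount 𝒯 Y x < 2 ^ (l + 1) := Nat.lt_pow_succ_log_self (by norm_num) _
    have h3 : k₀ < l + 1 := (Nat.pow_lt_pow_iff_right (by norm_num : 1 < 2)).1 (h.trans_lt h2)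
    have h4 : l < k₀ + J := (Nat.pow_lt_pow_iff_right (by norm_num : 1 < 2)).1 (h1.trans_lt (hJ x))
    simp only [Set.mem_iUnion, Finset.mem_range]
    refine ⟨l - k₀, by omega, hx, ?_⟩
    rw [show k₀ + (l - k₀) = l by omega]
    exact ⟨h1, by rw [pow_succ] at h2; omega⟩
  have hstep : ∑ T ∈ 𝒯, volume.real (Y T) ≤ ∑ T ∈ 𝒯, volume.real (Y T ∩ Low) +
      ∑ j ∈ Finset.range J, ∑ T ∈ 𝒯, volume.real (Y T ∩ multiplicityLevel 𝒯 Y (2 ^ (k₀ + j))) := by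
    rw [Finset.sum_comm, ← Finset.sum_add_distrib]
    refine Finset.sum_le_sum fun T hT => ?_
    refine (measureReal_mono (hcov T hT) ?_).trans ((measureReal_union_le _ _).trans ?_)
    · refine ((measure_mono (Set.union_subset Set.inter_subset_left
        (Set.iUnion₂_subset fun j _ => Set.inter_subset_left))).trans_lt (hYfin T hT).lt_top).ne
    · gcongr
      exact measureReal_biUnion_finset_le _ _
  refine hstep.trans (add_le_add ?_ (Finset.sum_le_sum fun j _ => ?_))
  · exact sum_le_mul_measureReal 𝒯 hLowfin hLowm hYm fun x hx => by
      have : coverCount 𝒯 Y x < 2 ^ k₀ := hx.2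
      exact_mod_cast this.le
  · rw [← mul_assoc]
    exact sum_le_mul_measureReal 𝒯 (volume_multiplicityLevel_ne_top hδ hYT Nat.one_le_two_pow)
      (measurableSet_multiplicityLevel hYm _) hYm fun x hx => by
        exact_mod_cast hx.2.le

open Classical in
theorem mul_multiplicityLevel_le {δ : ℝ} (hδ : 0 ≤ δ) {𝒯 : Finset Tube} {Y : Tube → Set R3}
    (hYT : ∀ T ∈ 𝒯, Y T ⊆ T.carrier δ) (hYm : ∀ T ∈ 𝒯, MeasurableSet (Y T)) {μ : ℕ}
    (hμ : 1 ≤ μ) :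
    μ * volume.real (multiplicityLevel 𝒯 Y μ) ≤ ∑ T ∈ 𝒯, volume.real (Y T) := by
  refine (mul_measureReal_le_sum 𝒯 (volume_multiplicityLevel_ne_top hδ hYT hμ)
    (measurableSet_multiplicityLevel hYm _) hYm fun x hx => Nat.cast_le.2 hx.1).trans ?_
  refine Finset.sum_le_sum fun T hT => measureReal_mono Set.inter_subset_left ?_
  exact ((measure_mono (hYT T hT)).trans_lt (T.volume_carrier_ne_top hδ).lt_top).ne

theorem sum_shading_bounds {K δ lam : ℝ} (hK : 1 ≤ K) (hδ : 0 < δ) (hlam : 0 < lam)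
    {𝒯 : Finset Tube} {Y : Tube → Set R3}
    (hsh : ∀ T ∈ 𝒯, IsShadingOfDensity K δ lam T (Y T)) :
    (4 * K)⁻¹ * (lam * (δ ^ 2 * (𝒯.card : ℝ))) ≤ ∑ T ∈ 𝒯, volume.real (Y T) ∧
      ∑ T ∈ 𝒯, volume.real (Y T) ≤ 4 * K * (lam * (δ ^ 2 * (𝒯.card : ℝ))) := by
  have hK0 : 0 < K := by linarith
  constructor
  · calc (4 * K)⁻¹ * (lam * (δ ^ 2 * (𝒯.card : ℝ)))
        = ∑ _T ∈ 𝒯, K⁻¹ * (lam * (δ ^ 2 / 4)) := by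
          rw [Finset.sum_const, nsmul_eq_mul, mul_inv]; ring
      _ ≤ _ := Finset.sum_le_sum fun T hT => le_trans (by
          have := T.le_volume_real_carrier hδ.le
          gcongr) (hsh T hT).2.2.1
  · calc _ ≤ ∑ _T ∈ 𝒯, K * (lam * δ ^ 2) := Finset.sum_le_sum fun T hT =>
          (hsh T hT).2.2.2.trans (by
            have := T.volume_real_carrier_le hδ.le
            gcongr)
      _ = K * (lam * (δ ^ 2 * (𝒯.card : ℝ))) := by
          rw [Finset.sum_const, nsmul_eq_mul]; ring
      _ ≤ _ := by gcongr; linarith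

/-! ### From the multiplicity to the volume: the theorem -/

/-- `V` is at least `M / (4 q n μ)`. Half of the loss `β` pays for `n`, the other half for the bound
on `μ`. -/
theorem volume_lower_bound_of_multiplicity {δ m lam M V μ C q n β s : ℝ} (hδ : 0 < δ) (hm : 0 < m)
    (hlam : 0 < lam) (hV : 0 ≤ V) (hμ : 0 ≤ μ) (hC : 0 < C) (hq : 0 < q)
    (hM : M ≤ 4 * q * n * (μ * V)) (hn : n ≤ C * δ ^ (-(β / 2)))
    (hmult : μ * lam ≤ C * δ ^ (-(β / 2 + s)) * (δ ^ (-(1 / 2) : ℝ) * m)) :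
    (4 * q * C ^ 2)⁻¹ * δ ^ (β + s) * (δ ^ (1 / 2 : ℝ) * m⁻¹ * lam * M) ≤ V := by
  have h1 : lam * M ≤ 4 * q * (C * δ ^ (-(β / 2))) *
      (C * δ ^ (-(β / 2 + s)) * (δ ^ (-(1 / 2) : ℝ) * m)) * V := by
    calc lam * M ≤ lam * (4 * q * n * (μ * V)) := by gcongr
      _ = 4 * q * n * (μ * lam) * V := by ring
      _ ≤ _ := by gcongr
  have h2 : δ ^ (β + s) * (δ ^ (-(β / 2)) * δ ^ (-(β / 2 + s))) = 1 := by
    rw [← Real.rpow_add hδ, ← Real.rpow_add hδ,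
      show β + s + (-(β / 2) + -(β / 2 + s)) = 0 by ring, Real.rpow_zero]
  have h3 : δ ^ (1 / 2 : ℝ) * δ ^ (-(1 / 2) : ℝ) = 1 := by
    rw [← Real.rpow_add hδ, add_neg_cancel, Real.rpow_zero]
  calc (4 * q * C ^ 2)⁻¹ * δ ^ (β + s) * (δ ^ (1 / 2 : ℝ) * m⁻¹ * lam * M)
      = (4 * q * C ^ 2)⁻¹ * δ ^ (β + s) * (δ ^ (1 / 2 : ℝ) * m⁻¹) * (lam * M) := by ring
    _ ≤ (4 * q * C ^ 2)⁻¹ * δ ^ (β + s) * (δ ^ (1 / 2 : ℝ) * m⁻¹) *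
        (4 * q * (C * δ ^ (-(β / 2))) *
          (C * δ ^ (-(β / 2 + s)) * (δ ^ (-(1 / 2) : ℝ) * m)) * V) := by gcongr
    _ = ((4 * q * C ^ 2)⁻¹ * (4 * q * C ^ 2)) *
        (δ ^ (β + s) * (δ ^ (-(β / 2)) * δ ^ (-(β / 2 + s)))) *
        (δ ^ (1 / 2 : ℝ) * δ ^ (-(1 / 2) : ℝ)) * (m⁻¹ * m) * V := by ring
    _ = V := by
      rw [h2, h3, inv_mul_cancel₀ (by positivity), inv_mul_cancel₀ hm.ne']; ring

set_option maxHeartbeats 1000000 in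
theorem mainTheorem2 (K : ℝ) (hK : 1 ≤ K) :
    ∃ C₁ : ℝ, 0 < C₁ ∧
    ∀ ε ε' : ℝ, 0 < ε → ε ^ 100 < ε' → ε' < ε →
    ∃ C : ℝ → ℝ, (∀ β : ℝ, 0 < β → 0 < C β) ∧
    ∀ (δ m lam : ℝ), 0 < δ → δ < 1 → 1 ≤ m → 0 < lam → lam < 1 →
    ∀ (𝒯 : Finset Tube) (Y : Tube → Set R3),
      DirectionsSeparated δ 𝒯 →
      ParallelAtMost (K * m) 𝒯 →
      (∀ T ∈ 𝒯, IsShadingOfDensity K δ lam T (Y T)) →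
      (∀ T ∈ 𝒯, IsTwoEnds K ε ε' δ T (Y T)) →
      -- the sum of the measures of the shadings is comparable to `λ δ² |𝒯|`
      (C₁⁻¹ * (lam * (δ ^ 2 * (𝒯.card : ℝ))) ≤ ∑ T ∈ 𝒯, volume.real (Y T) ∧
        ∑ T ∈ 𝒯, volume.real (Y T) ≤ C₁ * (lam * (δ ^ 2 * (𝒯.card : ℝ)))) ∧
      -- the volume bound for the union of the shadings, in its two forms
      (∀ β : ℝ, 0 < β →
        (C β)⁻¹ * δ ^ (β + (ε - ε') / 2) *
            (δ ^ (1 / 2 : ℝ) * m⁻¹ * lam * ∑ T ∈ 𝒯, volume.real (Y T))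
          ≤ volume.real (⋃ T ∈ 𝒯, Y T) ∧
        (C β)⁻¹ * δ ^ (β + (ε - ε') / 2) *
            (δ ^ (1 / 2 : ℝ) * m⁻¹ * lam ^ 2 * (δ ^ 2 * (𝒯.card : ℝ)))
          ≤ volume.real (⋃ T ∈ 𝒯, Y T)) ∧
      -- the typical multiplicity `μ = 2 ^ k`
      ((∀ p : R3, (coverCount 𝒯 (Tube.carrier δ) p : ℝ) ≤ K * δ ^ (-K)) →
        ∃ k : ℕ,
          (((2 ^ k : ℕ) : ℝ) * volume.real (multiplicityLevel 𝒯 Y (2 ^ k))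
            ≤ ∑ T ∈ 𝒯, volume.real (Y T)) ∧
          ∀ β : ℝ, 0 < β →
            (C β)⁻¹ * δ ^ β * ∑ T ∈ 𝒯, volume.real (Y T)
              ≤ ((2 ^ k : ℕ) : ℝ) * volume.real (multiplicityLevel 𝒯 Y (2 ^ k)) ∧
            (C β)⁻¹ * δ ^ (β + (ε - ε') / 2) *
                (δ ^ (1 / 2 : ℝ) * m⁻¹ * lam ^ 2 * (δ ^ 2 * (𝒯.card : ℝ)))
              ≤ volume.real (multiplicityLevel 𝒯 Y (2 ^ k)) ∧
            ((2 ^ k : ℕ) : ℝ) * lam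
              ≤ C β * δ ^ (-(β + (ε - ε') / 2)) * (δ ^ (-(1 / 2) : ℝ) * m) ∧
            ∀ j : ℕ,
              volume.real (multiplicityLevel 𝒯 Y (2 ^ j))
                ≤ C β * δ ^ (-β) *
                  (((2 ^ k : ℕ) : ℝ) * volume.real (multiplicityLevel 𝒯 Y (2 ^ k))
                    / ((2 ^ j : ℕ) : ℝ))) := by
  have hK0 : 0 < K := by linarith
  obtain ⟨q₀, hq₀⟩ := pow_unbounded_of_one_lt (23040 * K) (one_lt_two (α := ℝ))
  -- Since `2 ^ n ≥ 1 / δ`, a range of `Q * n` dyadic levels suffices: `q₀` absorbs the constant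
  -- `23040 K`, the `2` the factor `δ ^ (-2)` in the number of tubes, and `⌈K⌉₊` the assumed overlap
  -- `K δ ^ (-K)`.
  set Q : ℕ := q₀ + 2 + ⌈K⌉₊ with hQ
  have hQ1 : (1 : ℝ) ≤ Q := by rw [hQ]; exact_mod_cast (by omega : 1 ≤ q₀ + 2 + ⌈K⌉₊)
  refine ⟨4 * K, by positivity, fun ε ε' hε hεε' hε' => ?_⟩
  have hε'0 : 0 < ε' := lt_trans (by positivity) hεε'
  -- The value of `q` is the product of `4 K`, from comparing `M` with `λ δ² |𝒯|`, and `4 Q`, from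
  -- the number of levels.
  have hconst := fun β (hβ : 0 < β) => exists_multiplicity_const (q := 16 * K * Q) (β := β / 2)
    hK hε'0 hε' (by nlinarith) (half_pos hβ)
  choose! C₀ hC₀1 hC₀ using hconst
  refine ⟨fun β => 4 * K * (4 * Q * C₀ β ^ 2), fun β hβ => ?_, ?_⟩
  · have := hC₀1 β hβ
    positivity
  intro δ m lam hδ hδ1 hm hlam hlam1 𝒯 Y hsep hpar hsh htwo
  have hm0 : 0 < m := by linarith
  obtain ⟨n, hn, hn'⟩ := exists_dyadic_scale hδ hδ1
  have hn0 : 0 < n := Nat.pos_of_ne_zero fun h => by rw [h] at hn; norm_num at hn; linarith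
  have hYT : ∀ T ∈ 𝒯, Y T ⊆ T.carrier δ := fun T hT => (hsh T hT).1
  have hYm : ∀ T ∈ 𝒯, MeasurableSet (Y T) := fun T hT => (hsh T hT).2.1
  have hmass := sum_shading_bounds hK hδ hlam hsh
  set M := ∑ T ∈ 𝒯, volume.real (Y T) with hM
  set U := ⋃ T ∈ 𝒯, Y T with hU
  set s := (ε - ε') / 2 with hs
  have hs0 : 0 < s := by rw [hs]; linarith
  have hM0 : 0 ≤ M := Finset.sum_nonneg fun _ _ => measureReal_nonneg
  have hNM : lam * (δ ^ 2 * (𝒯.card : ℝ)) ≤ 4 * K * M := by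
    have := hmass.1
    rwa [inv_mul_le_iff₀ (by positivity)] at this
  have hmult : ∀ β, 0 < β → ∀ k : ℕ, 𝒯.Nonempty → M ≤ 4 * Q * n *
      (((2 ^ k : ℕ) : ℝ) * volume.real (multiplicityLevel 𝒯 Y (2 ^ k))) →
      ((2 ^ k : ℕ) : ℝ) * lam ≤ C₀ β * δ ^ (-(β / 2 + s)) * (δ ^ (-(1 / 2) : ℝ) * m) := by
    intro β hβ k h𝒯 hk
    refine (hC₀ β hβ δ n hδ hδ1 hn hn').2 m lam hm hlam hlam1 𝒯 Y hsep hpar hsh htwo h𝒯 _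
      Nat.one_le_two_pow (hNM.trans ?_)
    calc 4 * K * M ≤ 4 * K * (4 * Q * n *
        (((2 ^ k : ℕ) : ℝ) * volume.real (multiplicityLevel 𝒯 Y (2 ^ k)))) := by gcongr
      _ = _ := by ring
  have hlevel : ∀ β, 0 < β → ∀ k : ℕ, 𝒯.Nonempty → M ≤ 4 * Q * n *
      (((2 ^ k : ℕ) : ℝ) * volume.real (multiplicityLevel 𝒯 Y (2 ^ k))) →
      (4 * Q * C₀ β ^ 2)⁻¹ * δ ^ (β + s) * (δ ^ (1 / 2 : ℝ) * m⁻¹ * lam * M) ≤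
        volume.real (multiplicityLevel 𝒯 Y (2 ^ k)) := fun β hβ k h𝒯 hk =>
    volume_lower_bound_of_multiplicity hδ hm0 hlam measureReal_nonneg (Nat.cast_nonneg _)
      (by linarith [hC₀1 β hβ]) (by linarith) hk (hC₀ β hβ δ n hδ hδ1 hn hn').1
      (hmult β hβ k h𝒯 hk)
  have hweak : ∀ β, 0 < β →
      (4 * K * (4 * Q * C₀ β ^ 2))⁻¹ * δ ^ (β + s) * (δ ^ (1 / 2 : ℝ) * m⁻¹ * lam * M) ≤
      (4 * Q * C₀ β ^ 2)⁻¹ * δ ^ (β + s) * (δ ^ (1 / 2 : ℝ) * m⁻¹ * lam * M) ∧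
      (4 * K * (4 * Q * C₀ β ^ 2))⁻¹ * δ ^ (β + s) *
        (δ ^ (1 / 2 : ℝ) * m⁻¹ * lam ^ 2 * (δ ^ 2 * (𝒯.card : ℝ))) ≤
      (4 * Q * C₀ β ^ 2)⁻¹ * δ ^ (β + s) * (δ ^ (1 / 2 : ℝ) * m⁻¹ * lam * M) := by
    intro β hβ
    have hC := hC₀1 β hβ
    constructor
    · have hD : 0 < 4 * Q * C₀ β ^ 2 := by positivity
      have hinv : (4 * K * (4 * Q * C₀ β ^ 2))⁻¹ ≤ (4 * Q * C₀ β ^ 2)⁻¹ :=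
        inv_anti₀ hD (le_mul_of_one_le_left hD.le (by linarith))
      exact mul_le_mul_of_nonneg_right (mul_le_mul_of_nonneg_right hinv (by positivity))
        (by positivity)
    · calc _ = (4 * K * (4 * Q * C₀ β ^ 2))⁻¹ * δ ^ (β + s) *
            (δ ^ (1 / 2 : ℝ) * m⁻¹ * lam * (lam * (δ ^ 2 * (𝒯.card : ℝ)))) := by ring
        _ ≤ (4 * K * (4 * Q * C₀ β ^ 2))⁻¹ * δ ^ (β + s) *
            (δ ^ (1 / 2 : ℝ) * m⁻¹ * lam * (4 * K * M)) := by gcongr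
        _ = _ := by field_simp
  have hpow : ∀ {x : ℝ}, 0 < x → δ ^ x ≤ 1 := fun hx => Real.rpow_le_one hδ.le hδ1.le hx.le
  have h2n : 1 / δ ≤ 2 ^ n := by rw [div_le_iff₀ hδ]; linarith
  have h2Qn : ∀ p : ℕ, q₀ + p ≤ Q → 23040 * K * (1 / δ) ^ p < 2 ^ (Q * n) := by
    intro p hp
    have e : (2 : ℝ) ^ q₀ * (2 ^ n) ^ p ≤ 2 ^ (Q * n) := by
      rw [← pow_mul, ← pow_add]
      refine pow_le_pow_right₀ one_le_two ?_
      have h1 : q₀ ≤ q₀ * n := Nat.le_mul_of_pos_right _ hn0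
      have h2 : (q₀ + p) * n ≤ Q * n := Nat.mul_le_mul_right _ hp
      rw [add_mul] at h2
      rw [mul_comm n p]
      omega
    refine lt_of_lt_of_le ?_ e
    have h3 := pow_le_pow_left₀ (show 0 ≤ 1 / δ by positivity) h2n p
    calc 23040 * K * (1 / δ) ^ p < 2 ^ q₀ * (1 / δ) ^ p := by gcongr
      _ ≤ _ := by gcongr
  refine ⟨hmass, fun β hβ => ?_, fun hbdd => ?_⟩
  · have hmain : (4 * Q * C₀ β ^ 2)⁻¹ * δ ^ (β + s) * (δ ^ (1 / 2 : ℝ) * m⁻¹ * lam * M) ≤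
        volume.real U := by
      rcases 𝒯.eq_empty_or_nonempty with h𝒯 | h𝒯
      · have : M = 0 := by rw [hM, h𝒯, Finset.sum_empty]
        rw [this, mul_zero, mul_zero]
        exact measureReal_nonneg
      -- The levels start at `2 ^ (l + 1)`, between `m` and `2 m`. The number of tubes may be as
      -- large as a multiple of `m δ ^ (-2)`, so this keeps the number of levels independent of `m`.
      obtain ⟨l, hl, hl'⟩ := exists_nat_pow_near hm one_lt_two
      have hUfin := volume_biUnion_ne_top hδ.le hYT
      have hdy := sum_le_dyadic hδ.le hYT hYm (l + 1) (Q * n) fun x => by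
        classical
        have h1 : coverCount 𝒯 Y x ≤ 𝒯.card := Finset.card_filter_le _ _
        have h2 : (𝒯.card : ℝ) < 2 ^ (l + 1 + Q * n) := by
          refine (card_tubes_le hδ hδ1 hsep hpar (by positivity)).trans_lt ?_
          calc 23040 * (K * m) / δ ^ 2 = m * (23040 * K * (1 / δ) ^ 2) := by field_simp
            _ < 2 ^ (l + 1) * 2 ^ (Q * n) := by
              have := h2Qn 2 (by omega)
              gcongr
            _ = _ := (pow_add _ _ _).symm
        exact h1.trans_lt (by exact_mod_cast h2)
      by_cases hcase : ∃ j ∈ Finset.range (Q * n), M ≤ 4 * Q * n *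
          (((2 ^ (l + 1 + j) : ℕ) : ℝ) * volume.real (multiplicityLevel 𝒯 Y (2 ^ (l + 1 + j))))
      · obtain ⟨j, -, hj⟩ := hcase
        exact (hlevel β hβ _ h𝒯 hj).trans
          (measureReal_mono (multiplicityLevel_subset Nat.one_le_two_pow) hUfin)
      · push Not at hcase
        have hsum : ∑ j ∈ Finset.range (Q * n), 2 * (((2 ^ (l + 1 + j) : ℕ) : ℝ) *
            volume.real (multiplicityLevel 𝒯 Y (2 ^ (l + 1 + j)))) ≤ M / 2 := by
          have hQn : (0 : ℝ) < Q * n := by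
            have : (0 : ℝ) < n := by exact_mod_cast hn0
            positivity
          calc _ ≤ ∑ _j ∈ Finset.range (Q * n), M / (2 * (Q * n)) :=
                Finset.sum_le_sum fun j hj => by
                  rw [le_div_iff₀ (by positivity)]
                  linarith [hcase j hj]
            _ = M / 2 := by
                rw [Finset.sum_const, Finset.card_range, nsmul_eq_mul]
                push_cast
                field_simp
        -- When no level is rich, the levels hold at most half of the mass. The other half sits on
        -- points of multiplicity below `2 m`, which gives `|U| ≥ M / (4 m)`, more than needed.
        have hlow : M ≤ 4 * m * volume.real U := by
          have h1 : volume.real {x ∈ U | coverCount 𝒯 Y x < 2 ^ (l + 1)} ≤ volume.real U :=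
            measureReal_mono (fun x hx => hx.1) hUfin
          have h2 : (2 : ℝ) ^ (l + 1) * volume.real {x ∈ U | coverCount 𝒯 Y x < 2 ^ (l + 1)} ≤
              2 * m * volume.real U := by
            gcongr
            rw [pow_succ]; linarith
          linarith
        have hC := hC₀1 β hβ
        have e1 := hpow (show 0 < β + s by positivity)
        have e2 := hpow (show (0 : ℝ) < 1 / 2 by norm_num)
        calc _ ≤ (4 * Q * C₀ β ^ 2)⁻¹ * 1 * (1 * m⁻¹ * 1 * (4 * m * volume.real U)) := by gcongr
          _ = (Q * C₀ β ^ 2)⁻¹ * volume.real U := by field_simp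
          _ ≤ 1 * volume.real U := by
              gcongr
              exact inv_le_one_of_one_le₀ (one_le_mul_of_one_le_of_one_le hQ1 (one_le_pow₀ hC))
          _ = _ := one_mul _
    exact ⟨(hweak β hβ).1.trans hmain, (hweak β hβ).2.trans hmain⟩
  · set g : ℕ → ℝ := fun j =>
      ((2 ^ j : ℕ) : ℝ) * volume.real (multiplicityLevel 𝒯 Y (2 ^ j)) with hg
    have hg0 : ∀ j, 0 ≤ g j := fun j => by positivity
    have hcount : ∀ x, coverCount 𝒯 Y x < 2 ^ (0 + Q * n) := by
      intro x
      classical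
      have h1 : coverCount 𝒯 Y x ≤ coverCount 𝒯 (Tube.carrier δ) x := by
        refine Finset.card_le_card fun T hT => ?_
        rw [Finset.mem_filter] at hT ⊢
        exact ⟨hT.1, hYT T hT.1 hT.2⟩
      have h2 : δ ^ (-K) ≤ (1 / δ) ^ ⌈K⌉₊ := by
        rw [Real.rpow_neg hδ.le, ← Real.inv_rpow hδ.le, ← one_div, ← Real.rpow_natCast]
        exact Real.rpow_le_rpow_of_exponent_le ((one_le_div hδ).2 hδ1.le) (Nat.le_ceil K)
      have h3 : (coverCount 𝒯 Y x : ℝ) < 2 ^ (Q * n) := by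
        calc (coverCount 𝒯 Y x : ℝ) ≤ K * δ ^ (-K) := (Nat.cast_le.2 h1).trans (hbdd x)
          _ ≤ K * (1 / δ) ^ ⌈K⌉₊ := by gcongr
          _ ≤ 23040 * K * (1 / δ) ^ ⌈K⌉₊ := by gcongr; linarith
          _ < _ := h2Qn _ (by omega)
      rw [zero_add]
      exact_mod_cast h3
    have hdy := sum_le_dyadic hδ.le hYT hYm 0 (Q * n) hcount
    have hlow : {x ∈ U | coverCount 𝒯 Y x < 2 ^ 0} = ∅ := by
      refine Set.eq_empty_iff_forall_notMem.2 fun x ⟨hx, hx0⟩ => ?_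
      classical
      simp only [hU, Set.mem_iUnion, exists_prop] at hx
      obtain ⟨T, hT, hxT⟩ := hx
      have : 0 < coverCount 𝒯 Y x := Finset.card_pos.2 ⟨T, Finset.mem_filter.2 ⟨hT, hxT⟩⟩
      omega
    rw [hlow, measureReal_empty, mul_zero, zero_add] at hdy
    simp only [zero_add] at hdy hcount
    have hgbig : ∀ j, Q * n ≤ j → g j = 0 := by
      intro j hj
      have : multiplicityLevel 𝒯 Y (2 ^ j) = ∅ := by
        refine Set.eq_empty_iff_forall_notMem.2 fun x hx => ?_
        exact absurd ((hcount x).trans_le (Nat.pow_le_pow_right two_pos hj)) (not_lt.2 hx.1)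
      simp only [hg, this, measureReal_empty, mul_zero]
    -- The level of largest mass is chosen once, before `β`. Its maximality is also the last claim,
    -- the comparison with all other levels.
    obtain ⟨k, -, hk⟩ := Finset.exists_max_image (Finset.range (Q * n)) g
      (Finset.nonempty_range_iff.2 (Nat.mul_pos (by omega) hn0).ne')
    have hmax : ∀ j, g j ≤ g k := by
      intro j
      rcases lt_or_ge j (Q * n) with h | h
      · exact hk j (Finset.mem_range.2 h)
      · rw [hgbig j h]; exact hg0 k
    have hMk : M ≤ 4 * Q * n * g k := by
      calc M ≤ ∑ j ∈ Finset.range (Q * n), 2 * g j := hdy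
        _ ≤ ∑ _j ∈ Finset.range (Q * n), 2 * g k :=
          Finset.sum_le_sum fun j _ => by linarith [hmax j]
        _ = 2 * Q * n * g k := by
          rw [Finset.sum_const, Finset.card_range, nsmul_eq_mul]; push_cast; ring
        _ ≤ _ := by
          have := hg0 k
          gcongr; norm_num
    -- For an empty family every level is null and any `k` is maximal; `k = 0` is taken so that the
    -- upper bound for `2 ^ k * lam` still holds.
    obtain ⟨k, hmax, hMk, hkμ⟩ : ∃ k, (∀ j, g j ≤ g k) ∧ M ≤ 4 * Q * n * g k ∧
        (𝒯 = ∅ → k = 0) := by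
      rcases 𝒯.eq_empty_or_nonempty with h𝒯 | h𝒯
      · have hg00 : ∀ j, g j = 0 := fun j => by
          have hMz : M = 0 := by rw [hM, h𝒯, Finset.sum_empty]
          exact le_antisymm ((mul_multiplicityLevel_le hδ.le hYT hYm
            Nat.one_le_two_pow).trans hMz.le) (hg0 j)
        refine ⟨0, fun j => by rw [hg00, hg00], ?_, fun _ => rfl⟩
        rw [hg00, ← hg00 k]; exact hMk
      · exact ⟨k, hmax, hMk, fun h => absurd h h𝒯.ne_empty⟩
    refine ⟨k, mul_multiplicityLevel_le hδ.le hYT hYm Nat.one_le_two_pow, fun β hβ => ?_⟩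
    have hC := hC₀1 β hβ
    have hCsq : C₀ β ≤ C₀ β ^ 2 := by nlinarith
    have hCC : C₀ β ≤ 4 * K * (4 * Q * C₀ β ^ 2) := by
      have h1 : 1 ≤ 4 * K * (4 * (Q : ℝ)) := by nlinarith
      have := mul_le_mul h1 hCsq (by linarith) (by positivity)
      linarith
    have hδβ : δ ^ (-(β / 2)) ≤ δ ^ (-β) :=
      Real.rpow_le_rpow_of_exponent_ge hδ hδ1.le (by linarith)
    refine ⟨?_, ?_, ?_, fun j => ?_⟩
    · have h1 : δ ^ β * δ ^ (-β) = 1 := by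
        rw [← Real.rpow_add hδ, add_neg_cancel, Real.rpow_zero]
      have hnC := ((hC₀ β hβ δ n hδ hδ1 hn hn').1).trans
        (mul_le_mul_of_nonneg_left hδβ (by linarith))
      have hgk := hg0 k
      calc _ ≤ (4 * K * (4 * Q * C₀ β ^ 2))⁻¹ * δ ^ β * (4 * Q * (C₀ β * δ ^ (-β)) * g k) := by
            gcongr
            exact hMk.trans (by gcongr)
        _ = (K * (4 * C₀ β))⁻¹ * (δ ^ β * δ ^ (-β)) * g k := by field_simp
        _ ≤ 1 * 1 * g k := by
            rw [h1]
            gcongr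
            exact inv_le_one_of_one_le₀ (by nlinarith)
        _ = _ := by ring
    · rcases 𝒯.eq_empty_or_nonempty with h𝒯 | h𝒯
      · rw [h𝒯, Finset.card_empty, Nat.cast_zero, mul_zero, mul_zero, mul_zero]
        exact measureReal_nonneg
      · exact (hweak β hβ).2.trans (hlevel β hβ k h𝒯 hMk)
    · have hδs : δ ^ (-(β / 2 + s)) ≤ δ ^ (-(β + s)) :=
        Real.rpow_le_rpow_of_exponent_ge hδ hδ1.le (by linarith)
      rcases 𝒯.eq_empty_or_nonempty with h𝒯 | h𝒯
      · have e1 : 1 ≤ δ ^ (-(β + s)) :=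
          Real.one_le_rpow_of_pos_of_le_one_of_nonpos hδ hδ1.le (by linarith)
        have e2 : 1 ≤ δ ^ (-(1 / 2) : ℝ) :=
          Real.one_le_rpow_of_pos_of_le_one_of_nonpos hδ hδ1.le (by norm_num)
        rw [hkμ h𝒯]
        calc ((2 ^ 0 : ℕ) : ℝ) * lam ≤ 1 * 1 * (1 * 1) := by simpa using hlam1.le
          _ ≤ _ := by gcongr; linarith
      · refine (hmult β hβ k h𝒯 hMk).trans ?_
        gcongr
    · have e1 : 1 ≤ δ ^ (-β) :=
        Real.one_le_rpow_of_pos_of_le_one_of_nonpos hδ hδ1.le (by linarith)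
      have h2j : (0 : ℝ) < ((2 ^ j : ℕ) : ℝ) := by positivity
      rw [mul_div_assoc', le_div_iff₀ h2j]
      have := hg0 k
      calc _ = g j := mul_comm _ _
        _ ≤ 1 * 1 * g k := by linarith [hmax j]
        _ ≤ _ := by gcongr; linarith
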